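/- Consider real projective 3-space $P_3$ with affine part $\mathbb R^3$, the unit sphere $Q=\mathbb S_2\subset\mathbb R^3$, and the group $\Phi$ of all rotations about the $z$-axis $Z$. A point of $P_3$ is *interior* if every line through it meets $Q$ in exactly two points. A *gl star* is a set $\mathcal S$ of lines of $P_3$, each meeting $Q$ in exactly two points, such that every non-interior point lies on exactly one line of $\mathcal S$; it is *topological* if this line depends continuously on the point, and *rotational* if it is $\Phi$-invariant. A rotational gl star is said to be *in standard position* if it moreover contains the $x$-axis $X$. For $a>0$ let $H_a$ be the hyperbola or line pair $a^2x^2-(z-b)^2=c^2$ in the $(x,z)$-plane $\mathbb R\times 0\times\mathbb R$, where $b=b(a)$ and $c=c(a)\ge 0$ are continuous functions of $a\in\,]0,\infty[$. Assume that 1. $b(a)^2+c(a)^2<a^2$ for all $a>0$; 2. $\lim_{a\to0}b(a)=0=\lim_{a\to 0}\frac{c(a)}{a}$; 3. every point $p_t=(\sqrt{1-t^2},0,t)$ with $0\neq t\in\,]-1,1[$ belongs to exactly one set $H_a$; 4. every point $(x,0,z)$ with $x\ge 0$, $z\ne 0$ and $x^2+z^2\ge 1$ belongs to at most one set $H_a$.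 Then $Z$, the orbit $\Phi X$ of the $x$-axis, all lines contained in the cones $\Phi H_a$ with $c(a)=0$, and the right reguli of the hyperboloids $\Phi H_a$ with $c(a)\neq0$ together form a topological rotational gl star in standard position. The same holds if the right reguli are replaced by left reguli for all $a$ in any collection of connected components of $\{a>0 : c(a)\ne0\}$. (A line of a hyperboloid $\Phi H_a$ belongs to the right, respectively left, regulus if, when traversed so that its projection to the $(x,y)$-plane turns counterclockwise about the origin, $z$ increases, respectively decreases.) Conversely, every topological rotational gl star in standard position arises in this way, for suitable $b$, $c$ satisfying (1)–(4) and a suitable choice of right and left reguli. -/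

import Mathlib

open Set Filter Topology

noncomputable section

namespace GlStar

/-! ### Real projective 3-space -/

/-- The vector space `ℝ⁴` with homogeneous coordinates `(x, y, z, w)`; the affine part `ℝ³` of the
projective space is `w = 1`. -/
abbrev E : Type := EuclideanSpace ℝ (Fin 4)

/-- The Grassmann manifold of `k`-dimensional subspaces of `ℝ⁴`. -/
def Gr (k : ℕ) : Type := {V : Submodule ℝ E // Module.finrank ℝ V = k}

/-- The usual topology of the Grassmann manifold: a subspace is identified with the orthogonal
projection onto it. -/
instance (k : ℕ) : TopologicalSpace (Gr k) :=
  TopologicalSpace.induced (fun V : Gr k => (V.1.starProjection : E →L[ℝ] E)) inferInstance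

/-- Points of real projective 3-space. -/
abbrev Point : Type := Gr 1

/-- Lines of real projective 3-space. -/
abbrev Line : Type := Gr 2

/-- Incidence of points and lines. -/
def Incident (p : Point) (L : Line) : Prop := p.1 ≤ L.1

theorem hom_ne_zero (x y z : ℝ) : (!₂[x, y, z, 1] : E) ≠ 0 := by
  intro h
  have h3 := congrArg (fun v : E => v 3) h
  simp at h3

/-- The point `(x, y, z)` of the affine part `ℝ³`. -/
def aff (x y z : ℝ) : Point :=
  ⟨Submodule.span ℝ {(!₂[x, y, z, 1] : E)}, finrank_span_singleton (hom_ne_zero x y z)⟩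

/-- The line spanned by two linearly independent vectors. -/
def lineOf (u v : E) (h : LinearIndependent ℝ ![u, v]) : Line :=
  ⟨Submodule.span ℝ (Set.range ![u, v]), by simpa using finrank_span_eq_card h⟩

theorem linearIndependent_xAxis :
    LinearIndependent ℝ ![(!₂[0, 0, 0, 1] : E), !₂[1, 0, 0, 0]] := by
  rw [LinearIndependent.pair_iff]
  intro s t h
  have h0 := congrArg (fun v : E => v 0) h
  have h3 := congrArg (fun v : E => v 3) h
  simp at h0 h3
  exact ⟨h3, h0⟩

theorem linearIndependent_zAxis :
    LinearIndependent ℝ ![(!₂[0, 0, 0, 1] : E), !₂[0, 0, 1, 0]] := by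
  rw [LinearIndependent.pair_iff]
  intro s t h
  have h2 := congrArg (fun v : E => v 2) h
  have h3 := congrArg (fun v : E => v 3) h
  simp at h2 h3
  exact ⟨h3, h2⟩

/-- The `x`-axis `X`. -/
def xAxis : Line := lineOf !₂[0, 0, 0, 1] !₂[1, 0, 0, 0] linearIndependent_xAxis

/-- The `z`-axis `Z`. -/
def zAxis : Line := lineOf !₂[0, 0, 0, 1] !₂[0, 0, 1, 0] linearIndependent_zAxis

/-! ### The rotation group `Φ` about the `z`-axis -/

/-- The linear map of `ℝ⁴` inducing the rotation of `ℝ³` about the `z`-axis through the angle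
`θ`. -/
def rotLin (θ : ℝ) : E →ₗ[ℝ] E where
  toFun v := !₂[Real.cos θ * v 0 - Real.sin θ * v 1, Real.sin θ * v 0 + Real.cos θ * v 1, v 2, v 3]
  map_add' u v := by
    ext i
    fin_cases i <;> simp <;> ring
  map_smul' r v := by
    ext i
    fin_cases i <;> simp <;> ring

theorem rotLin_rotLin_neg (θ : ℝ) (v : E) : rotLin θ (rotLin (-θ) v) = v := by
  have h := Real.sin_sq_add_cos_sq θ
  ext i
  fin_cases i
  · simp [rotLin]
    linear_combination (v 0) * h
  · simp [rotLin]
    linear_combination (v 1) * h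
  · simp [rotLin]
  · simp [rotLin]

/-- `rotLin` as a linear automorphism of `ℝ⁴`. -/
def rot (θ : ℝ) : E ≃ₗ[ℝ] E :=
  LinearEquiv.ofLinearMap (rotLin θ) (rotLin (-θ))
    (LinearMap.ext fun v => rotLin_rotLin_neg θ v)
    (LinearMap.ext fun v => by simpa using rotLin_rotLin_neg (-θ) v)

/-- The action of the rotation through the angle `θ` on points and lines. -/
def rotGr {k : ℕ} (θ : ℝ) (V : Gr k) : Gr k :=
  ⟨V.1.map (rot θ : E →ₗ[ℝ] E), by rw [LinearEquiv.finrank_map_eq]; exact V.2⟩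

/-! ### Generalized line stars with respect to the unit sphere -/

/-- The elliptic quadric `Q`: the unit sphere in the affine part `ℝ³`. -/
def Q : Set Point := {p | ∃ x y z : ℝ, x ^ 2 + y ^ 2 + z ^ 2 = 1 ∧ p = aff x y z}

/-- A 2-secant is a line that meets `Q` in exactly two points. -/
def IsTwoSecant (L : Line) : Prop := {p : Point | p ∈ Q ∧ Incident p L}.ncard = 2

/-- A point is interior if every line containing it is a 2-secant. -/
def IsInterior (p : Point) : Prop := ∀ L : Line, Incident p L → IsTwoSecant L

/-- A gl star: a set of 2-secants such that every non-interior point is on precisely one of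
them. -/
structure IsGlStar (S : Set Line) : Prop where
  two_secant : ∀ L ∈ S, IsTwoSecant L
  existsUnique_line : ∀ p : Point, ¬ IsInterior p → ∃! L : Line, L ∈ S ∧ Incident p L

/-- A gl star is topological if the line of the star containing a given non-interior point depends
continuously on that point. -/
structure IsTopologicalGlStar (S : Set Line) : Prop extends IsGlStar S where
  continuous_line : ∃ f : {p : Point // ¬ IsInterior p} → Line,
    Continuous f ∧ ∀ p, f p ∈ S ∧ Incident p.1 (f p)

/-- Invariance under the group `Φ` of rotations about the `z`-axis. -/
def IsRotational (S : Set Line) : Prop := ∀ θ : ℝ, ∀ L ∈ S, rotGr θ L ∈ S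

/-- A topological rotational gl star (with quadric `Q` and rotation group `Φ`). -/
structure IsTopologicalRotationalGlStar (S : Set Line) : Prop extends IsTopologicalGlStar S where
  rotational : IsRotational S

/-- Standard position: besides the normalizations of the quadric (the unit sphere) and of the
rotation axis (the `z`-axis), which are built into `Q` and `rotGr`, the horizontal lines of the star
that meet the rotation axis inside the sphere pass through the origin, i.e. the `x`-axis belongs to
the star. -/
structure IsTopologicalRotationalGlStarInStandardPosition (S : Set Line) : Prop
    extends IsTopologicalRotationalGlStar S where
  xAxis_mem : xAxis ∈ S

/-! ### Hyperbolas, hyperboloids, cones and reguli -/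

/-- The hyperbola or line pair `H_a` with equation `a² x² - (z - b)² = c²` in the `(x, z)`-plane,
where `b = b(a)` and `c = c(a)`. -/
def H (b c : ℝ → ℝ) (a : ℝ) : Set (ℝ × ℝ) :=
  {q | a ^ 2 * q.1 ^ 2 - (q.2 - b a) ^ 2 = c a ^ 2}

/-- The surface `Φ H_a` (a hyperboloid if `c(a) ≠ 0`, a cone if `c(a) = 0`), where the
`(x, z)`-plane is the plane `y = 0` of `ℝ³`. -/
def surface (b c : ℝ → ℝ) (a : ℝ) : Set Point :=
  {p | ∃ q ∈ H b c a, ∃ θ : ℝ, p = rotGr θ (aff q.1 0 q.2)}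

/-- The line `L` is not a line at infinity, and all its affine points belong to `A`. -/
def AffinelyContained (L : Line) (A : Set Point) : Prop :=
  (∃ x y z : ℝ, Incident (aff x y z) L) ∧ ∀ x y z : ℝ, Incident (aff x y z) L → aff x y z ∈ A

/-- The two kinds of reguli. -/
inductive Hand : Type
  | right
  | left

/-- `(x₀ + τ x₁, y₀ + τ y₁, z₀ + τ z₁)`, `τ ∈ ℝ`, is a parametrization of the affine part of
`L`. -/
def IsParametrization (L : Line) (x₀ y₀ z₀ x₁ y₁ z₁ : ℝ) : Prop :=
  (x₁, y₁, z₁) ≠ (0, 0, 0) ∧ ∀ τ : ℝ, Incident (aff (x₀ + τ * x₁) (y₀ + τ * y₁) (z₀ + τ * z₁)) L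

/-- A line belongs to a right (left) regulus if it can be parametrized in such a way that
`(x, y)` rotates counterclockwise about the `z`-axis (that is, `x y' - y x' > 0`; for a
parametrization as above this expression is `x₀ y₁ - y₀ x₁`) and `z` is increasing
(decreasing). -/
def HasHand : Hand → Line → Prop
  | .right, L => ∃ x₀ y₀ z₀ x₁ y₁ z₁ : ℝ,
      IsParametrization L x₀ y₀ z₀ x₁ y₁ z₁ ∧ 0 < x₀ * y₁ - y₀ * x₁ ∧ 0 < z₁
  | .left, L => ∃ x₀ y₀ z₀ x₁ y₁ z₁ : ℝ,
      IsParametrization L x₀ y₀ z₀ x₁ y₁ z₁ ∧ 0 < x₀ * y₁ - y₀ * x₁ ∧ z₁ < 0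

/-- The conditions on the functions `b` and `c` on `]0, ∞[`. -/
structure Admissible (b c : ℝ → ℝ) : Prop where
  continuousOn_b : ContinuousOn b (Ioi 0)
  continuousOn_c : ContinuousOn c (Ioi 0)
  c_nonneg : ∀ a : ℝ, 0 < a → 0 ≤ c a
  /-- `H_a` meets the `x`-axis inside the unit circle. -/
  sq_lt : ∀ a : ℝ, 0 < a → b a ^ 2 + c a ^ 2 < a ^ 2
  tendsto_b : Tendsto b (𝓝[>] 0) (𝓝 0)
  tendsto_c_div : Tendsto (fun a => c a / a) (𝓝[>] 0) (𝓝 0)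
  /-- Every point `(√(1 - t²), t)`, `0 ≠ t ∈ ]-1, 1[`, is on exactly one `H_a`. -/
  circle : ∀ t : ℝ, t ∈ Ioo (-1) 1 → t ≠ 0 → ∃! a : ℝ, 0 < a ∧ (Real.sqrt (1 - t ^ 2), t) ∈ H b c a
  /-- Points with `x ≥ 0`, `z ≠ 0` and `x² + z² ≥ 1` are on at most one `H_a`. -/
  exterior : ∀ x z : ℝ, 0 ≤ x → z ≠ 0 → 1 ≤ x ^ 2 + z ^ 2 →
    ∀ a a' : ℝ, 0 < a → 0 < a' → (x, z) ∈ H b c a → (x, z) ∈ H b c a' → a = a'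

/-- The choice of right or left reguli is constant on every interval without zeros of `c`. -/
def AdmissibleChoice (c : ℝ → ℝ) (ε : ℝ → Hand) : Prop :=
  ∀ a a' : ℝ, 0 < a → a ≤ a' → (∀ r ∈ Icc a a', c r ≠ 0) → ε a = ε a'

/-- The set of lines consisting of `Z`, the orbit `Φ X`, all lines contained in the cones `Φ H_a`,
`c(a) = 0`, and one regulus of each of the hyperboloids `Φ H_a`, `c(a) ≠ 0`, chosen by `ε`. -/
def star (b c : ℝ → ℝ) (ε : ℝ → Hand) : Set Line :=
  {zAxis} ∪ {L | ∃ θ : ℝ, L = rotGr θ xAxis}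
    ∪ {L | ∃ a : ℝ, 0 < a ∧ c a = 0 ∧ AffinelyContained L (surface b c a)}
    ∪ {L | ∃ a : ℝ, 0 < a ∧ c a ≠ 0 ∧ AffinelyContained L (surface b c a) ∧ HasHand (ε a) L}

end GlStar

end

open Set Filter Topology

noncomputable section

namespace GlStar

/-! ### Points and lines -/

/-! A rotational star is encoded by two real functions of the slope. The line `genLine θ a b σ` has
slope `a`, signed distance `σ` from `Z`, and height `b` where it is closest to `Z`. For `a > 0` its
rotates form a cone (`σ = 0`) or one regulus of the hyperboloid with `c = a|σ|`, and the sign of `σ`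
selects the regulus. Choosing reguli thus means choosing a sign for `c/a`. Constancy of the choice
between zeros of `c` makes `σ` continuous.

From functions to stars: a rotate of the line of slope `a` passes through an affine point at height
`z` iff the squared distance of the point from `Z` is `absSq b c z a = ((z - b)² + c²)/a²`. For `z ≠
0` this tends to infinity as `a → 0` and, by a convexity argument
(`Admissible.eventually_absSq_lt`), to 0 as `a → ∞`. The intermediate value theorem gives existence
of a line and condition (4) gives uniqueness. In the plane `z = 0`, condition (1) leaves only the
rotates of `X`; at infinity the direction determines the slope. Since `b/a` and `σ` tend to 0, the
steep lines converge to `Z`. The line set is therefore compact, and a closed graph argument makes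
the star topological.

From stars to functions: the star line through the point at infinity `(1, 0, a)` defines `b(a)` and
`σ(a)`. It crosses `z = 0` inside the sphere, because all other points of that plane lie on rotates
of `X`; this is (1), and it also bounds `b` and `σ`, so that their continuity follows from that of
the star. Conditions (3) and (4) restate that an exterior point lies on one star line, which has one
slope. -/

theorem ext_coords {u v : E} (h0 : u 0 = v 0) (h1 : u 1 = v 1) (h2 : u 2 = v 2)
    (h3 : u 3 = v 3) : u = v := by
  ext i
  fin_cases i <;> assumption

theorem line_eq_of_le {L L' : Line} (h : L.1 ≤ L'.1) : L = L' :=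
  Subtype.ext (Submodule.eq_of_le_of_finrank_eq h (L.2.trans L'.2.symm))

theorem line_eq_lineOf {L : Line} {u v : E} (h : LinearIndependent ℝ ![u, v]) (hu : u ∈ L.1)
    (hv : v ∈ L.1) : L = lineOf u v h := by
  symm
  apply line_eq_of_le
  apply Submodule.span_le.2
  rintro _ ⟨i, rfl⟩
  fin_cases i
  · exact hu
  · exact hv

theorem mem_lineOf {u v w : E} (h : LinearIndependent ℝ ![u, v]) :
    w ∈ (lineOf u v h).1 ↔ ∃ s t : ℝ, s • u + t • v = w := by
  have : Set.range ![u, v] = {u, v} := by simp [Set.pair_comm]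
  simp only [lineOf, this, Submodule.mem_span_pair]

theorem line_eq_of_mem {L L' : Line} {u v : E} (h : LinearIndependent ℝ ![u, v]) (hu : u ∈ L.1)
    (hv : v ∈ L.1) (hu' : u ∈ L'.1) (hv' : v ∈ L'.1) : L = L' :=
  (line_eq_lineOf h hu hv).trans (line_eq_lineOf h hu' hv').symm

/-- The point with homogeneous coordinates `v`. -/
def pointOf (v : E) (h : v ≠ 0) : Point :=
  ⟨Submodule.span ℝ {v}, finrank_span_singleton h⟩

theorem incident_pointOf {v : E} {h : v ≠ 0} {L : Line} : Incident (pointOf v h) L ↔ v ∈ L.1 :=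
  Submodule.span_singleton_le_iff_mem _ _

theorem exists_eq_pointOf (p : Point) : ∃ (v : E) (h : v ≠ 0), p = pointOf v h := by
  obtain ⟨v, hv, hs⟩ := finrank_eq_one_iff'.1 p.2
  refine ⟨v, by simpa using hv, ?_⟩
  symm
  refine Subtype.ext (Submodule.eq_of_le_of_finrank_eq ?_ ?_)
  · exact (Submodule.span_singleton_le_iff_mem _ _).2 v.2
  · exact (pointOf _ _).2.trans p.2.symm

theorem pointOf_eq_pointOf {u v : E} {hu : u ≠ 0} {hv : v ≠ 0} :
    pointOf u hu = pointOf v hv ↔ ∃ c : ℝ, c • v = u := by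
  constructor
  · intro h
    have : u ∈ (pointOf v hv).1 := by
      rw [← h]
      exact Submodule.mem_span_singleton_self u
    exact Submodule.mem_span_singleton.1 this
  · rintro ⟨c, rfl⟩
    refine Subtype.ext (Submodule.span_singleton_smul_eq ?_ v)
    refine IsUnit.mk0 c ?_
    rintro rfl
    simp at hu

theorem aff_eq_pointOf (x y z : ℝ) : aff x y z = pointOf !₂[x, y, z, 1] (hom_ne_zero x y z) := rfl

theorem incident_aff {x y z : ℝ} {L : Line} :
    Incident (aff x y z) L ↔ (!₂[x, y, z, 1] : E) ∈ L.1 :=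
  incident_pointOf (h := hom_ne_zero x y z)

theorem pointOf_eq_aff {v : E} (h : v ≠ 0) (h3 : v 3 ≠ 0) :
    pointOf v h = aff (v 0 / v 3) (v 1 / v 3) (v 2 / v 3) := by
  rw [aff_eq_pointOf, pointOf_eq_pointOf]
  refine ⟨v 3, ext_coords ?_ ?_ ?_ ?_⟩ <;> simp <;> field_simp

/-- Every line contains a nonzero vector in the hyperplane at infinity. -/
theorem exists_mem_infinity (L : Line) : ∃ v ∈ L.1, v ≠ 0 ∧ v 3 = 0 := by
  obtain ⟨b⟩ : Nonempty (Module.Basis (Fin 2) ℝ L.1) :=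
    ⟨Module.finBasisOfFinrankEq ℝ L.1 L.2⟩
  have hli := b.linearIndependent
  set u := b 0 with hu
  set v := b 1 with hv
  have hli : LinearIndependent ℝ ![u, v] := by
    convert hli using 1
    ext i
    fin_cases i <;> rfl
  rw [LinearIndependent.pair_iff] at hli
  by_cases h : (u : E) 3 = 0
  · refine ⟨u, u.2, ?_, h⟩
    intro h0
    have := hli 1 0 (by ext1; simp [h0])
    simp at this
  · refine ⟨(v : E) 3 • (u : E) - (u : E) 3 • (v : E), ?_, ?_, ?_⟩
    · exact L.1.sub_mem (L.1.smul_mem _ u.2) (L.1.smul_mem _ v.2)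
    · intro h0
      have := hli ((v : E) 3) (-(u : E) 3) (by
        ext1
        simpa [sub_eq_add_neg] using h0)
      exact h (by simpa using this.2)
    · simp
      ring

/-! ### The quadratic form of the sphere -/

/-- The quadratic form defining `Q`. -/
def qf (v : E) : ℝ := v 0 ^ 2 + v 1 ^ 2 + v 2 ^ 2 - v 3 ^ 2

theorem pointOf_mem_Q {v : E} {h : v ≠ 0} : pointOf v h ∈ Q ↔ qf v = 0 := by
  constructor
  · rintro ⟨x, y, z, h1, h2⟩
    rw [aff_eq_pointOf, pointOf_eq_pointOf] at h2
    obtain ⟨c, rfl⟩ := h2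
    simp [qf]
    linear_combination c ^ 2 * h1
  · intro hq
    have h3 : v 3 ≠ 0 := by
      intro h3
      apply h
      simp only [qf, h3] at hq
      apply ext_coords <;> simp [h3] <;> nlinarith [sq_nonneg (v 0), sq_nonneg (v 1),
        sq_nonneg (v 2)]
    refine ⟨_, _, _, ?_, pointOf_eq_aff h h3⟩
    field_simp
    simp only [qf] at hq
    linarith

/-- If `y` is the point at infinity of the line, then `qf y > 0`, so `y` is not on `Q`, and `qf (x +
t • y)` is a quadratic in `t` with positive leading and negative constant coefficient. Its two real
roots are the two points of `Q`. -/
theorem isTwoSecant_of_qf_neg {L : Line} {x : E} (hx : x ∈ L.1) (hq : qf x < 0) :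
    IsTwoSecant L := by
  have hx3 : x 3 ≠ 0 := by
    intro h
    simp only [qf, h] at hq
    nlinarith [sq_nonneg (x 0), sq_nonneg (x 1), sq_nonneg (x 2)]
  obtain ⟨y, hy, hy0, hy3⟩ := exists_mem_infinity L
  have hA : 0 < qf y := by
    by_contra hneg
    apply hy0
    simp only [qf, hy3] at hneg
    apply ext_coords <;> simp [hy3] <;> nlinarith [sq_nonneg (y 0), sq_nonneg (y 1),
        sq_nonneg (y 2)]
  have hli : LinearIndependent ℝ ![x, y] := by
    rw [LinearIndependent.pair_iff]
    intro s t hst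
    have h3 := congrArg (fun v : E => v 3) hst
    simp [hy3, hx3] at h3
    subst h3
    simpa [hy0] using hst
  obtain rfl := line_eq_lineOf hli hx hy
  set B := x 0 * y 0 + x 1 * y 1 + x 2 * y 2 with hB
  have hexp : ∀ t : ℝ, qf (x + t • y) = qf y * t ^ 2 + 2 * B * t + qf x := by
    intro t
    simp [qf, hy3, hB]
    ring
  have hD : 0 < B ^ 2 - qf y * qf x := by nlinarith [sq_nonneg B]
  set r := Real.sqrt (B ^ 2 - qf y * qf x) with hr
  have hr0 : 0 < r := Real.sqrt_pos.2 hD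
  have hr2 : r ^ 2 = B ^ 2 - qf y * qf x := Real.sq_sqrt hD.le
  have hne : ∀ t : ℝ, x + t • y ≠ 0 := by
    intro t h
    have h3 := congrArg (fun v : E => v 3) h
    simp [hy3, hx3] at h3
  rw [IsTwoSecant, Set.ncard_eq_two]
  refine ⟨pointOf (x + ((-B + r) / qf y) • y) (hne _),
    pointOf (x + ((-B - r) / qf y) • y) (hne _), ?_, ?_⟩
  · rw [Ne, pointOf_eq_pointOf]
    rintro ⟨c, hc⟩
    rw [LinearIndependent.pair_iff] at hli
    have := hli (c - 1) (c * ((-B - r) / qf y) - (-B + r) / qf y) (by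
      rw [← sub_eq_zero.2 hc]
      module)
    obtain ⟨h1, h2⟩ := this
    have hc1 : c = 1 := by linarith
    subst hc1
    field_simp at h2
    linarith
  · ext p
    simp only [mem_ofPred_eq, mem_insert_iff, mem_singleton_iff]
    constructor
    · rintro ⟨hp, hi⟩
      obtain ⟨v, hv, rfl⟩ := exists_eq_pointOf p
      rw [pointOf_mem_Q] at hp
      rw [incident_pointOf, mem_lineOf] at hi
      obtain ⟨s, t, rfl⟩ := hi
      have hs : s ≠ 0 := by
        rintro rfl
        have ht : t ≠ 0 := by
          rintro rfl
          simp at hv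
        have : qf (0 • x + t • y) = t ^ 2 * qf y := by
          simp [qf]
          ring
        rw [zero_smul] at this hp
        rw [hp] at this
        have : 0 < t ^ 2 * qf y := by positivity
        linarith
      have hq2 : qf (x + (t / s) • y) = 0 := by
        have : qf (s • x + t • y) = s ^ 2 * qf (x + (t / s) • y) := by
          simp [qf]
          field_simp
        rw [hp] at this
        simpa [hs] using this.symm
      rw [hexp] at hq2
      have hfac : (t / s - (-B + r) / qf y) * (t / s - (-B - r) / qf y) = 0 := by
        have : qf y * ((t / s - (-B + r) / qf y) * (t / s - (-B - r) / qf y)) = 0 := by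
          rw [← hq2]
          field_simp
          ring_nf
          rw [hr2]
          ring
        simpa [hA.ne'] using this
      have key : ∀ ρ : ℝ, t / s - ρ = 0 → ∃ c : ℝ, c • (x + ρ • y) = s • x + t • y := by
        intro ρ hρ
        refine ⟨s, ?_⟩
        have : s * ρ = t := by
          have : ρ = t / s := by linarith
          rw [this]
          field_simp
        rw [smul_add, smul_smul, this]
      rcases mul_eq_zero.1 hfac with h | h
      · exact Or.inl (pointOf_eq_pointOf.2 (key _ h))
      · exact Or.inr (pointOf_eq_pointOf.2 (key _ h))
    · have key : ∀ ρ : ℝ, qf y * ρ ^ 2 + 2 * B * ρ + qf x = 0 →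
          pointOf (x + ρ • y) (hne ρ) ∈ Q ∧ Incident (pointOf (x + ρ • y) (hne ρ))
            (lineOf x y hli) := by
        intro ρ hρ
        rw [pointOf_mem_Q, hexp, incident_pointOf, mem_lineOf]
        exact ⟨hρ, 1, ρ, by simp⟩
      rintro (rfl | rfl)
      · apply key
        field_simp
        linear_combination hr2
      · apply key
        field_simp
        linear_combination hr2

/-- If `qf v ≥ 0`, take `y` at infinity orthogonal to `v`. Then `qf (s • v + t • y) = s² qf v + t²
qf y` with `qf y > 0`, so the line through `v` and `y` meets `Q` at most in `v`. -/
theorem isInterior_iff {v : E} {h : v ≠ 0} : IsInterior (pointOf v h) ↔ qf v < 0 := by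
  constructor
  · intro hi
    by_contra hq
    push Not at hq
    obtain ⟨y, hy0, hy3, hort⟩ : ∃ y : E, y ≠ 0 ∧ y 3 = 0 ∧
        v 0 * y 0 + v 1 * y 1 + v 2 * y 2 = 0 := by
      by_cases h0 : v 0 = 0 ∧ v 1 = 0
      · refine ⟨!₂[1, 0, 0, 0], ?_, by simp, by simp [h0]⟩
        intro h
        simpa using congrArg (fun v : E => v 0) h
      · refine ⟨!₂[-v 1, v 0, 0, 0], ?_, by simp, by simp; ring⟩
        intro h
        have h1 := congrArg (fun v : E => v 0) h
        have h2 := congrArg (fun v : E => v 1) h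
        simp at h1 h2
        exact h0 ⟨h2, h1⟩
    have hA : 0 < qf y := by
      by_contra hneg
      apply hy0
      simp only [qf, hy3] at hneg
      apply ext_coords <;> simp [hy3] <;> nlinarith [sq_nonneg (y 0), sq_nonneg (y 1),
          sq_nonneg (y 2)]
    have hv : 0 < v 0 ^ 2 + v 1 ^ 2 + v 2 ^ 2 := by
      by_contra hneg
      apply h
      simp only [qf] at hq
      apply ext_coords <;> simp <;> nlinarith [sq_nonneg (v 0), sq_nonneg (v 1),
          sq_nonneg (v 2), sq_nonneg (v 3)]
    have hli : LinearIndependent ℝ ![v, y] := by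
      rw [LinearIndependent.pair_iff]
      intro s t hst
      have e0 := congrArg (fun v : E => v 0) hst
      have e1 := congrArg (fun v : E => v 1) hst
      have e2 := congrArg (fun v : E => v 2) hst
      simp at e0 e1 e2
      have hs : s * (v 0 ^ 2 + v 1 ^ 2 + v 2 ^ 2) = 0 := by
        linear_combination v 0 * e0 + v 1 * e1 + v 2 * e2 - t * hort
      have hs : s = 0 := by simpa [hv.ne'] using hs
      subst hs
      simpa [hy0] using hst
    have h2 := hi (lineOf v y hli) (by
      rw [incident_pointOf, mem_lineOf]
      exact ⟨1, 0, by simp⟩)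
    have hsub : {p : Point | p ∈ Q ∧ Incident p (lineOf v y hli)} ⊆ {pointOf v h} := by
      rintro p ⟨hp, hi⟩
      obtain ⟨w, hw, rfl⟩ := exists_eq_pointOf p
      rw [pointOf_mem_Q] at hp
      rw [incident_pointOf, mem_lineOf] at hi
      obtain ⟨s, t, rfl⟩ := hi
      rw [mem_singleton_iff, pointOf_eq_pointOf]
      have hexp : qf (s • v + t • y) = s ^ 2 * qf v + t ^ 2 * qf y := by
        simp [qf, hy3]
        linear_combination 2 * s * t * hort
      rw [hexp] at hp
      have ht : t ^ 2 * qf y = 0 := by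
        linarith [mul_nonneg (sq_nonneg s) hq, mul_nonneg (sq_nonneg t) hA.le]
      have ht : t = 0 := by simpa [hA.ne'] using ht
      exact ⟨s, by simp [ht]⟩
    have := Set.ncard_le_ncard hsub
    rw [IsTwoSecant] at h2
    rw [h2, Set.ncard_singleton] at this
    omega
  · intro hq L hL
    exact isTwoSecant_of_qf_neg (incident_pointOf.1 hL) hq

/-! ### The topology of the Grassmann manifolds -/

theorem continuous_starProjection (k : ℕ) :
    Continuous fun V : Gr k => (V.1.starProjection : E →L[ℝ] E) :=
  continuous_induced_dom

instance (k : ℕ) : T2Space (Gr k) :=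
  T2Space.of_injective_continuous
    (fun _ _ h => Subtype.ext (Submodule.starProjection_inj.1 h)) (continuous_starProjection k)

/-- In terms of orthogonal projections, incidence is the closed condition `P_L ∘ P_p = P_p`. -/
theorem isClosed_incident : IsClosed {x : Point × Line | Incident x.1 x.2} := by
  have : {x : Point × Line | Incident x.1 x.2} =
      {x | (x.2.1.starProjection : E →L[ℝ] E) ∘L x.1.1.starProjection = x.1.1.starProjection} := by
    ext x
    simp only [mem_ofPred_eq, Incident]
    constructor
    · intro h
      ext1 v
      exact Submodule.starProjection_eq_self_iff.2 (h (Submodule.starProjection_apply_mem _ v))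
    · intro h v hv
      have := DFunLike.congr_fun h v
      simp only [ContinuousLinearMap.comp_apply, Submodule.starProjection_eq_self_iff.2 hv] at this
      exact Submodule.starProjection_eq_self_iff.1 this
  rw [this]
  exact isClosed_eq
    (((continuous_starProjection 2).comp continuous_snd).clm_comp
      ((continuous_starProjection 1).comp continuous_fst))
    ((continuous_starProjection 1).comp continuous_fst)

theorem continuous_pointOf {X : Type*} [TopologicalSpace X] {v : X → E} (hv : Continuous v)
    (h : ∀ x, v x ≠ 0) : Continuous fun x => pointOf (v x) (h x) := by
  refine continuous_induced_rng.2 ?_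
  have : (fun x => ((pointOf (v x) (h x)).1.starProjection : E →L[ℝ] E)) =
      fun x => (‖v x‖ ^ 2)⁻¹ • (innerSL ℝ (v x)).smulRight (v x) := by
    ext1 x
    ext1 w
    simp [pointOf, Submodule.starProjection_singleton, smul_smul]
    congr 1
    ring
  change Continuous (fun x => ((pointOf (v x) (h x)).1.starProjection : E →L[ℝ] E))
  rw [this]
  have h' : ∀ x, ‖v x‖ ^ 2 ≠ 0 := fun x => by simpa using h x
  have : Continuous fun x => (innerSL ℝ (v x)).smulRight (v x) := by fun_prop
  fun_prop (disch := assumption)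

/-- The projection is written out with the inverse Gram matrix of `u`, `v`. The Gram determinant `D`
does not vanish, since equality in Cauchy–Schwarz would make `u`, `v` dependent. -/
theorem continuous_lineOf {X : Type*} [TopologicalSpace X] {u v : X → E} (hu : Continuous u)
    (hv : Continuous v) (h : ∀ x, LinearIndependent ℝ ![u x, v x]) :
    Continuous fun x => lineOf (u x) (v x) (h x) := by
  refine continuous_induced_rng.2 ?_
  change Continuous (fun x => ((lineOf (u x) (v x) (h x)).1.starProjection : E →L[ℝ] E))
  set D : X → ℝ := fun x => ‖u x‖ ^ 2 * ‖v x‖ ^ 2 - inner ℝ (u x) (v x) ^ 2 with hD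
  have hD0 : ∀ x, D x ≠ 0 := by
    intro x h0
    have hx := h x
    have h1 : |inner ℝ (u x) (v x)| = ‖u x‖ * ‖v x‖ := by
      rw [← abs_of_nonneg (mul_nonneg (norm_nonneg (u x)) (norm_nonneg (v x))),
        ← sq_eq_sq_iff_abs_eq_abs]
      simp only [hD] at h0
      linear_combination -h0
    have hu0 : u x ≠ 0 := hx.ne_zero 0
    have hv0 : v x ≠ 0 := hx.ne_zero 1
    have h2 : ‖inner ℝ (u x) (v x)‖ = ‖u x‖ * ‖v x‖ := by rwa [Real.norm_eq_abs]
    have h3 : u x = 0 ∨ ∃ r : ℝ, v x = r • u x :=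
      ((norm_inner_eq_norm_tfae ℝ (u x) (v x)).out 0 2).1 h2
    obtain ⟨r, hr⟩ := h3.resolve_left hu0
    rw [LinearIndependent.pair_iff] at hx
    have := hx r (-1) (by simp [hr])
    simp at this
  have : (fun x => ((lineOf (u x) (v x) (h x)).1.starProjection : E →L[ℝ] E)) =
      fun x => (D x)⁻¹ •
        ((‖v x‖ ^ 2 • innerSL ℝ (u x) - inner ℝ (u x) (v x) • innerSL ℝ (v x)).smulRight (u x) +
        (‖u x‖ ^ 2 • innerSL ℝ (v x) - inner ℝ (u x) (v x) • innerSL ℝ (u x)).smulRight (v x)) := by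
    ext1 x
    ext1 w
    apply Submodule.eq_starProjection_of_mem_of_inner_eq_zero
    · rw [mem_lineOf]
      refine ⟨(D x)⁻¹ * (‖v x‖ ^ 2 * inner ℝ (u x) w - inner ℝ (u x) (v x) * inner ℝ (v x) w),
        (D x)⁻¹ * (‖u x‖ ^ 2 * inner ℝ (v x) w - inner ℝ (u x) (v x) * inner ℝ (u x) w), ?_⟩
      simp [smul_smul]
    · intro y hy
      rw [mem_lineOf] at hy
      obtain ⟨s, t, rfl⟩ := hy
      have := hD0 x
      simp only [inner_sub_left, inner_add_right, inner_smul_right, inner_add_left,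
        inner_smul_left, smul_apply, add_apply, sub_apply, ContinuousLinearMap.smulRight_apply,
        innerSL_apply_apply, smul_eq_mul, real_inner_self_eq_norm_sq, conj_trivial]
      rw [real_inner_comm (u x) w, real_inner_comm (v x) w, real_inner_comm (u x) (v x)]
      field_simp
      simp only [hD]
      ring
  rw [this]
  have h1 : Continuous D := by fun_prop
  have h2 : Continuous fun x => inner ℝ (u x) (v x) := by fun_prop
  have h3 : Continuous fun x => (‖v x‖ ^ 2 • innerSL ℝ (u x) -
      inner ℝ (u x) (v x) • innerSL ℝ (v x)).smulRight (u x) := by fun_prop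
  have h4 : Continuous fun x => (‖u x‖ ^ 2 • innerSL ℝ (v x) -
      inner ℝ (u x) (v x) • innerSL ℝ (u x)).smulRight (v x) := by fun_prop
  exact (h1.inv₀ hD0).smul (h3.add h4)

/-! ### The lines of a rotational gl star -/

theorem linearIndependent_genLine (θ a b σ : ℝ) :
    LinearIndependent ℝ ![(!₂[Real.sin θ * σ, -(Real.cos θ * σ), b, 1] : E),
      !₂[Real.cos θ, Real.sin θ, a, 0]] := by
  rw [LinearIndependent.pair_iff]
  intro s t h
  have h0 := congrArg (fun v : E => v 0) h
  have h1 := congrArg (fun v : E => v 1) h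
  have h3 := congrArg (fun v : E => v 3) h
  simp at h0 h1 h3
  subst h3
  refine ⟨rfl, ?_⟩
  linear_combination Real.cos θ * h0 + Real.sin θ * h1 - t * Real.sin_sq_add_cos_sq θ

/-- The line `x + i y = exp (i θ) (τ - i σ)`, `z = b + τ a`, of slope `a`. -/
def genLine (θ a b σ : ℝ) : Line := lineOf _ _ (linearIndependent_genLine θ a b σ)

theorem mem_genLine {θ a b σ : ℝ} {v : E} : v ∈ (genLine θ a b σ).1 ↔
    ∃ t : ℝ, v 0 = v 3 * (Real.sin θ * σ) + t * Real.cos θ ∧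
      v 1 = -(v 3 * (Real.cos θ * σ)) + t * Real.sin θ ∧ v 2 = v 3 * b + t * a := by
  rw [genLine, mem_lineOf]
  constructor
  · rintro ⟨s, t, rfl⟩
    exact ⟨t, by simp, by simp, by simp⟩
  · rintro ⟨t, h0, h1, h2⟩
    refine ⟨v 3, t, ext_coords ?_ ?_ ?_ ?_⟩ <;> simp [h0, h1, h2]

theorem mem_zAxis {v : E} : v ∈ zAxis.1 ↔ v 0 = 0 ∧ v 1 = 0 := by
  rw [zAxis, mem_lineOf]
  constructor
  · rintro ⟨s, t, rfl⟩
    simp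
  · rintro ⟨h0, h1⟩
    refine ⟨v 3, v 2, ext_coords ?_ ?_ ?_ ?_⟩ <;> simp [h0, h1]

theorem genLine_zero : genLine 0 0 0 0 = xAxis := by
  symm
  apply line_eq_lineOf
  · rw [xAxis, mem_lineOf]
    exact ⟨1, 0, by ext i; fin_cases i <;> simp⟩
  · rw [xAxis, mem_lineOf]
    exact ⟨0, 1, by ext i; fin_cases i <;> simp⟩

theorem rot_apply (θ : ℝ) (v : E) : rot θ v =
    !₂[Real.cos θ * v 0 - Real.sin θ * v 1, Real.sin θ * v 0 + Real.cos θ * v 1, v 2, v 3] := rfl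

theorem rot_symm_apply (θ : ℝ) (v : E) : (rot θ).symm v = rot (-θ) v := rfl

theorem mem_rotGr {k : ℕ} {θ : ℝ} {V : Gr k} {v : E} :
    v ∈ (rotGr θ V).1 ↔ rot (-θ) v ∈ V.1 := by
  rw [← rot_symm_apply]
  exact Submodule.mem_map_equiv _

theorem rotGr_genLine (φ θ a b σ : ℝ) :
    rotGr φ (genLine θ a b σ) = genLine (φ + θ) a b σ := by
  apply line_eq_lineOf
  · rw [mem_rotGr, mem_genLine]
    have h := Real.sin_sq_add_cos_sq φ
    refine ⟨0, ?_, ?_, ?_⟩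
    · simp [rot_apply, Real.sin_add, Real.cos_add]
      linear_combination (Real.sin θ * σ) * h
    · simp [rot_apply, Real.sin_add, Real.cos_add]
      linear_combination (-(Real.cos θ * σ)) * h
    · simp [rot_apply]
  · rw [mem_rotGr, mem_genLine]
    have h := Real.sin_sq_add_cos_sq φ
    refine ⟨1, ?_, ?_, ?_⟩
    · simp [rot_apply, Real.sin_add, Real.cos_add]
      linear_combination (Real.cos θ) * h
    · simp [rot_apply, Real.sin_add, Real.cos_add]
      linear_combination (Real.sin θ) * h
    · simp [rot_apply]

theorem rotGr_zAxis (φ : ℝ) : rotGr φ zAxis = zAxis := by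
  apply line_eq_lineOf <;> rw [mem_rotGr, mem_zAxis] <;> simp [rot_apply]

theorem rotGr_xAxis (φ : ℝ) : rotGr φ xAxis = genLine φ 0 0 0 := by
  rw [← genLine_zero, rotGr_genLine, add_zero]

theorem exists_angle {p q r : ℝ} (hr : 0 < r) (h : p ^ 2 + q ^ 2 = r ^ 2) :
    ∃ θ : ℝ, p = r * Real.cos θ ∧ q = r * Real.sin θ := by
  refine ⟨Complex.arg ⟨p, q⟩, ?_⟩
  have hn : ‖(⟨p, q⟩ : ℂ)‖ = r := by
    rw [← abs_of_pos hr, ← abs_of_nonneg (norm_nonneg (⟨p, q⟩ : ℂ)), ← sq_eq_sq_iff_abs_eq_abs,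
      Complex.sq_norm, Complex.normSq_mk, ← h]
    ring
  constructor
  · rw [← hn, Complex.norm_mul_cos_arg]
  · rw [← hn, Complex.norm_mul_sin_arg]

/-- A vector `(r, s)` of the plane can be rotated to any other vector of the same length. -/
theorem exists_rotation {x y r s : ℝ} (h : x ^ 2 + y ^ 2 = r ^ 2 + s ^ 2) :
    ∃ θ : ℝ, x = r * Real.cos θ - s * Real.sin θ ∧ y = r * Real.sin θ + s * Real.cos θ := by
  by_cases h0 : r ^ 2 + s ^ 2 = 0
  · have hx : x = 0 := by nlinarith [sq_nonneg x, sq_nonneg y]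
    have hy : y = 0 := by nlinarith [sq_nonneg x, sq_nonneg y]
    have hr : r = 0 := by nlinarith [sq_nonneg r, sq_nonneg s]
    have hs : s = 0 := by nlinarith [sq_nonneg r, sq_nonneg s]
    exact ⟨0, by simp [hx, hr, hs], by simp [hy, hr, hs]⟩
  · obtain ⟨θ, h1, h2⟩ := exists_angle (p := (x * r + y * s) / (r ^ 2 + s ^ 2))
      (q := (y * r - x * s) / (r ^ 2 + s ^ 2)) one_pos (by
        field_simp
        linear_combination (r ^ 2 + s ^ 2) * h)
    rw [one_mul] at h1 h2
    refine ⟨θ, ?_, ?_⟩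
    · rw [← h1, ← h2]
      field_simp
      ring
    · rw [← h1, ← h2]
      field_simp
      ring

/-! ### Cones, hyperboloids and reguli -/

theorem rotGr_aff (θ x y z : ℝ) : rotGr θ (aff x y z) =
    aff (Real.cos θ * x - Real.sin θ * y) (Real.sin θ * x + Real.cos θ * y) z := by
  symm
  refine Subtype.ext (Submodule.eq_of_le_of_finrank_eq ?_ ?_)
  · rw [aff, Submodule.span_singleton_le_iff_mem]
    refine Submodule.mem_map.2 ⟨!₂[x, y, z, 1], Submodule.mem_span_singleton_self _, ?_⟩
    change rot θ _ = _
    simp [rot_apply]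
  · exact (aff _ _ _).2.trans (rotGr θ _).2.symm

theorem aff_inj {x y z x' y' z' : ℝ} (h : aff x y z = aff x' y' z') :
    x = x' ∧ y = y' ∧ z = z' := by
  rw [aff_eq_pointOf, aff_eq_pointOf, pointOf_eq_pointOf] at h
  obtain ⟨c, hc⟩ := h
  have h0 := congrArg (fun v : E => v 0) hc
  have h1 := congrArg (fun v : E => v 1) hc
  have h2 := congrArg (fun v : E => v 2) hc
  have h3 := congrArg (fun v : E => v 3) hc
  simp at h0 h1 h2 h3
  subst h3
  simp at h0 h1 h2
  exact ⟨h0.symm, h1.symm, h2.symm⟩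

theorem aff_mem_surface {b c : ℝ → ℝ} {a x y z : ℝ} : aff x y z ∈ surface b c a ↔
    a ^ 2 * (x ^ 2 + y ^ 2) - (z - b a) ^ 2 = c a ^ 2 := by
  constructor
  · rintro ⟨⟨r, s⟩, hq, θ, h⟩
    rw [rotGr_aff] at h
    obtain ⟨rfl, rfl, rfl⟩ := aff_inj h
    simp only [H, mem_ofPred_eq] at hq
    rw [← hq]
    linear_combination a ^ 2 * r ^ 2 * Real.sin_sq_add_cos_sq θ
  · intro h
    obtain ⟨θ, h1, h2⟩ := exists_rotation (x := x) (y := y) (r := Real.sqrt (x ^ 2 + y ^ 2))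
      (s := 0) (by rw [Real.sq_sqrt (by positivity)]; ring)
    refine ⟨(Real.sqrt (x ^ 2 + y ^ 2), z), ?_, θ, ?_⟩
    · simp only [H, mem_ofPred_eq]
      rw [Real.sq_sqrt (by positivity)]
      exact h
    · rw [rotGr_aff]
      congr 1
      · linarith
      · linarith

theorem aff_incident_genLine {θ a b σ x y z : ℝ} : Incident (aff x y z) (genLine θ a b σ) ↔
    ∃ t : ℝ, x = Real.sin θ * σ + t * Real.cos θ ∧ y = -(Real.cos θ * σ) + t * Real.sin θ ∧
      z = b + t * a := by
  rw [incident_aff, mem_genLine]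
  simp

theorem genLine_affinelyContained {b c : ℝ → ℝ} {a σ : ℝ} (θ : ℝ)
    (hσ : c a ^ 2 = a ^ 2 * σ ^ 2) :
    AffinelyContained (genLine θ a (b a) σ) (surface b c a) := by
  refine ⟨⟨_, _, _, aff_incident_genLine.2 ⟨0, rfl, rfl, rfl⟩⟩, ?_⟩
  intro x y z h
  obtain ⟨t, rfl, rfl, rfl⟩ := aff_incident_genLine.1 h
  rw [aff_mem_surface, hσ]
  linear_combination a ^ 2 * (σ ^ 2 + t ^ 2) * Real.sin_sq_add_cos_sq θ

/-- Along the line, the equation of the surface is a polynomial identity of degree 2 in the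
parameter. Its leading coefficient forces slope `±a`, and its linear coefficient makes the point of
height `b a` the one closest to `Z`. -/
theorem exists_genLine_of_affinelyContained {b c : ℝ → ℝ} {a : ℝ} (ha : 0 < a) {L : Line}
    (hL : AffinelyContained L (surface b c a)) :
    ∃ θ σ : ℝ, c a ^ 2 = a ^ 2 * σ ^ 2 ∧ L = genLine θ a (b a) σ := by
  obtain ⟨⟨x₀, y₀, z₀, h₀⟩, hL⟩ := hL
  obtain ⟨d, hd, hd0, hd3⟩ := exists_mem_infinity L
  have hpt : ∀ t : ℝ, Incident (aff (x₀ + t * d 0) (y₀ + t * d 1) (z₀ + t * d 2)) L := by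
    intro t
    rw [incident_aff] at h₀ ⊢
    convert L.1.add_mem h₀ (L.1.smul_mem t hd) using 1
    ext i
    fin_cases i <;> simp [hd3]
  have heq : ∀ t : ℝ, a ^ 2 * ((x₀ + t * d 0) ^ 2 + (y₀ + t * d 1) ^ 2) -
      (z₀ + t * d 2 - b a) ^ 2 = c a ^ 2 := fun t => aff_mem_surface.1 (hL _ _ _ (hpt t))
  have e0 := heq 0
  have e1 := heq 1
  have e2 := heq (-1)
  have hdir : a ^ 2 * (d 0 ^ 2 + d 1 ^ 2) = d 2 ^ 2 := by linear_combination (e1 + e2) / 2 - e0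
  have hmix : a ^ 2 * (x₀ * d 0 + y₀ * d 1) = (z₀ - b a) * d 2 := by
    linear_combination (e1 - e2) / 4
  have hd2 : d 2 ≠ 0 := by
    intro h2
    have : d 0 ^ 2 + d 1 ^ 2 = 0 := by simpa [h2, ha.ne'] using hdir
    apply hd0
    apply ext_coords <;> simp [hd3, h2] <;> nlinarith [sq_nonneg (d 0), sq_nonneg (d 1)]
  obtain ⟨θ, h1, h2⟩ := exists_angle (p := a * d 0 / d 2) (q := a * d 1 / d 2) one_pos (by
    field_simp
    linear_combination hdir)
  rw [one_mul] at h1 h2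
  have hd0' : d 0 = d 2 / a * Real.cos θ := by rw [← h1]; field_simp
  have hd1' : d 1 = d 2 / a * Real.sin θ := by rw [← h2]; field_simp
  have hcs := Real.sin_sq_add_cos_sq θ
  have hmix' : a * (x₀ * Real.cos θ + y₀ * Real.sin θ) = z₀ - b a := by
    have : d 2 * (a * (x₀ * Real.cos θ + y₀ * Real.sin θ)) = d 2 * (z₀ - b a) := by
      rw [mul_comm (d 2) (z₀ - b a), ← hmix, hd0', hd1']
      field_simp
    exact mul_left_cancel₀ hd2 this
  -- The witness for `σ` is the signed distance from the origin to the projection of the line to the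
  -- `(x, y)`-plane.
  refine ⟨θ, x₀ * Real.sin θ - y₀ * Real.cos θ, ?_, ?_⟩
  · rw [← e0]
    linear_combination (a * (x₀ * Real.cos θ + y₀ * Real.sin θ) + (z₀ - b a)) * hmix' -
      a ^ 2 * (x₀ ^ 2 + y₀ ^ 2) * hcs
  · apply line_eq_lineOf
    · have h := incident_aff.1 (hpt (-(z₀ - b a) / d 2))
      convert h using 1
      have k0 : Real.sin θ * (x₀ * Real.sin θ - y₀ * Real.cos θ) =
          x₀ + -(z₀ - b a) / d 2 * d 0 := by
        rw [hd0', ← hmix']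
        field_simp
        linear_combination x₀ * hcs
      have k1 : -(Real.cos θ * (x₀ * Real.sin θ - y₀ * Real.cos θ)) =
          y₀ + -(z₀ - b a) / d 2 * d 1 := by
        rw [hd1', ← hmix']
        field_simp
        linear_combination y₀ * hcs
      have k2 : b a = z₀ + -(z₀ - b a) / d 2 * d 2 := by
        field_simp
        ring
      rw [← k0, ← k1, ← k2]
    · convert L.1.smul_mem (a / d 2) hd using 1
      refine ext_coords ?_ ?_ ?_ ?_
      · simp [hd0']
        field_simp
      · simp [hd1']
        field_simp
      · simp
        field_simp
      · simp [hd3]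

/-- The sign of a hand. -/
def Hand.sign : Hand → ℝ
  | .right => 1
  | .left => -1

/-- Every parametrization satisfies `a (x₀ y₁ - y₀ x₁) = z₁ σ`, so for a counterclockwise one the
signs of `z₁` and `σ` agree. -/
theorem hasHand_genLine {θ a b σ : ℝ} (ha : 0 < a) (h : Hand) :
    HasHand h (genLine θ a b σ) ↔ 0 < h.sign * σ := by
  have hcs := Real.sin_sq_add_cos_sq θ
  have key : ∀ {x₀ y₀ z₀ x₁ y₁ z₁ : ℝ},
      IsParametrization (genLine θ a b σ) x₀ y₀ z₀ x₁ y₁ z₁ →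
        a * (x₀ * y₁ - y₀ * x₁) = z₁ * σ := by
    rintro x₀ y₀ z₀ x₁ y₁ z₁ ⟨-, h⟩
    obtain ⟨s, hx, hy, hz⟩ := aff_incident_genLine.1 (h 0)
    obtain ⟨t, hx', hy', hz'⟩ := aff_incident_genLine.1 (h 1)
    have h1 : x₁ = (t - s) * Real.cos θ := by linear_combination hx' - hx
    have h2 : y₁ = (t - s) * Real.sin θ := by linear_combination hy' - hy
    have h3 : z₁ = (t - s) * a := by linear_combination hz' - hz
    have h4 : x₀ = Real.sin θ * σ + s * Real.cos θ := by linear_combination hx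
    have h5 : y₀ = -(Real.cos θ * σ) + s * Real.sin θ := by linear_combination hy
    rw [h1, h2, h3, h4, h5]
    linear_combination a * (t - s) * σ * hcs
  have hpar : ∀ r : ℝ, r ≠ 0 → IsParametrization (genLine θ a b σ)
      (Real.sin θ * σ) (-(Real.cos θ * σ)) b (r * Real.cos θ) (r * Real.sin θ) (r * a) := by
    intro r hr
    refine ⟨fun h => ?_, fun t => aff_incident_genLine.2 ⟨t * r, ?_, ?_, ?_⟩⟩
    · simp [hr, ha.ne'] at h
    all_goals ring
  cases h
  · simp only [HasHand, Hand.sign, one_mul]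
    constructor
    · rintro ⟨x₀, y₀, z₀, x₁, y₁, z₁, hp, h1, h2⟩
      have := key hp
      have h3 : 0 < z₁ * σ := by rw [← this]; positivity
      exact (mul_pos_iff_of_pos_left h2).1 h3
    · intro hσ
      refine ⟨_, _, _, _, _, _, hpar 1 one_ne_zero, ?_, by linarith⟩
      linear_combination hσ + (-σ) * hcs
  · simp only [HasHand, Hand.sign]
    constructor
    · rintro ⟨x₀, y₀, z₀, x₁, y₁, z₁, hp, h1, h2⟩
      have := key hp
      have h3 : 0 < z₁ * σ := by rw [← this]; positivity
      nlinarith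
    · intro hσ
      refine ⟨_, _, _, _, _, _, hpar (-1) (by norm_num), ?_, by linarith⟩
      linear_combination hσ + σ * hcs

/-- The lines of the star with slope `a`. -/
theorem mem_cone_or_regulus_iff {b c : ℝ → ℝ} {a : ℝ} (ha : 0 < a) (hc : 0 ≤ c a) (h : Hand)
    {L : Line} :
    (c a = 0 ∧ AffinelyContained L (surface b c a)) ∨
      (c a ≠ 0 ∧ AffinelyContained L (surface b c a) ∧ HasHand h L) ↔
    ∃ θ : ℝ, L = genLine θ a (b a) (h.sign * (c a / a)) := by
  have hs : h.sign ^ 2 = 1 := by cases h <;> simp [Hand.sign]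
  constructor
  · rintro (⟨h0, hL⟩ | ⟨h0, hL, hh⟩)
    · obtain ⟨θ, σ, h1, rfl⟩ := exists_genLine_of_affinelyContained ha hL
      refine ⟨θ, ?_⟩
      have : σ = 0 := by simpa [h0, ha.ne'] using h1
      simp [this, h0]
    · obtain ⟨θ, σ, h1, rfl⟩ := exists_genLine_of_affinelyContained ha hL
      refine ⟨θ, ?_⟩
      rw [hasHand_genLine ha] at hh
      have h2 : a * (h.sign * σ) = c a := by
        rw [← abs_of_nonneg hc, ← abs_of_pos (mul_pos ha hh), ← sq_eq_sq_iff_abs_eq_abs]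
        linear_combination -h1 + a ^ 2 * σ ^ 2 * hs
      congr 1
      rw [← h2]
      field_simp
      rw [hs, mul_one]
  · rintro ⟨θ, rfl⟩
    have hcont : AffinelyContained (genLine θ a (b a) (h.sign * (c a / a))) (surface b c a) := by
      apply genLine_affinelyContained
      field_simp
      rw [hs]
      ring
    by_cases h0 : c a = 0
    · exact Or.inl ⟨h0, hcont⟩
    · refine Or.inr ⟨h0, hcont, ?_⟩
      rw [hasHand_genLine ha]
      have : 0 < c a := lt_of_le_of_ne hc (Ne.symm h0)
      have h2 : h.sign * (h.sign * (c a / a)) = c a / a := by linear_combination (c a / a) * hs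
      rw [h2]
      positivity

/-! ### The hyperbolas of an admissible family -/

/-- The square of the abscissa of the points with ordinate `z` on `H_a`. -/
def absSq (b c : ℝ → ℝ) (z a : ℝ) : ℝ := ((z - b a) ^ 2 + c a ^ 2) / a ^ 2

theorem mem_H_iff {b c : ℝ → ℝ} {a x z : ℝ} (ha : 0 < a) :
    (x, z) ∈ H b c a ↔ absSq b c z a = x ^ 2 := by
  simp only [H, absSq, mem_ofPred_eq]
  rw [div_eq_iff (by positivity)]
  constructor <;> intro h <;> linarith

theorem absSq_nonneg (b c : ℝ → ℝ) (z a : ℝ) : 0 ≤ absSq b c z a := by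
  unfold absSq
  positivity

theorem mem_H_sqrt_iff {b c : ℝ → ℝ} {a t : ℝ} (ha : 0 < a) (ht : t ∈ Ioo (-1 : ℝ) 1) :
    (Real.sqrt (1 - t ^ 2), t) ∈ H b c a ↔ absSq b c t a = 1 - t ^ 2 := by
  rw [mem_H_iff ha, Real.sq_sqrt]
  nlinarith [ht.1, ht.2]

namespace Admissible

variable {b c : ℝ → ℝ}

theorem continuousOn_absSq (h : Admissible b c) (z : ℝ) :
    ContinuousOn (absSq b c z) (Ioi 0) := by
  have hb := h.continuousOn_b
  have hc := h.continuousOn_c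
  unfold absSq
  refine ContinuousOn.div (by fun_prop) (by fun_prop) ?_
  intro a ha
  exact pow_ne_zero _ (ne_of_gt ha)

theorem tendsto_absSq_zero (h : Admissible b c) {z : ℝ} (hz : z ≠ 0) :
    Tendsto (absSq b c z) (𝓝[>] 0) atTop := by
  have h1 : Tendsto (fun a : ℝ => (a ^ 2)⁻¹) (𝓝[>] 0) atTop := by
    have := (tendsto_inv_nhdsGT_zero (𝕜 := ℝ)).atTop_mul_atTop₀ (tendsto_inv_nhdsGT_zero (𝕜 := ℝ))
    refine this.congr fun a => ?_
    rw [← mul_inv, sq]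
  have h2 : Tendsto (fun a => (z - b a) ^ 2) (𝓝[>] 0) (𝓝 ((z - 0) ^ 2)) :=
    (tendsto_const_nhds.sub h.tendsto_b).pow 2
  have h3 := h2.pos_mul_atTop (by rw [sub_zero]; positivity) h1
  refine tendsto_atTop_mono (fun a => ?_) h3
  rw [absSq, div_eq_mul_inv]
  gcongr
  nlinarith [sq_nonneg (c a)]

/-- Below `a₀`, all values greater than the one at `a₀` are attained. -/
theorem exists_absSq_eq_of_lt (h : Admissible b c) {z a₀ y : ℝ} (hz : z ≠ 0) (ha₀ : 0 < a₀)
    (hy : absSq b c z a₀ < y) : ∃ a, 0 < a ∧ a < a₀ ∧ absSq b c z a = y := by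
  have h1 : ∀ᶠ a in 𝓝[>] (0 : ℝ), y ≤ absSq b c z a :=
    (h.tendsto_absSq_zero hz).eventually_ge_atTop y
  have h2 : ∀ᶠ a in 𝓝[>] (0 : ℝ), a ∈ Ioo 0 a₀ := Ioo_mem_nhdsGT ha₀
  obtain ⟨a₁, ha1, ha2, ha3⟩ := (h1.and h2).exists
  obtain ⟨a, ha, hay⟩ := intermediate_value_Icc' ha3.le
    ((h.continuousOn_absSq z).mono fun a ha => ha2.trans_le ha.1) ⟨hy.le, ha1⟩
  refine ⟨a, ha2.trans_le ha.1, lt_of_le_of_ne ha.2 ?_, hay⟩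
  rintro rfl
  exact hy.ne hay

/-- Choose `s` of the same sign as `t` with `|t| < |s| < 1`, and let `H_{a₁}` pass through the
circle point of height `s`. The function `z ↦ absSq b c z a₁ + z²` is convex, equals 1 at `s` and is
less than 1 at 0 by (1), hence is less than 1 at `t`. The value `1 - t²` is already attained at some
`a₂ < a₁`, so by the uniqueness in (3) it is never attained beyond `a₁`. -/
theorem eventually_absSq_lt (h : Admissible b c) {t : ℝ} (ht : t ∈ Ioo (-1 : ℝ) 1) (ht0 : t ≠ 0) :
    ∀ᶠ a in atTop, absSq b c t a < 1 - t ^ 2 := by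
  have habs : |t| < 1 := abs_lt.2 ht
  have ht2 : t ^ 2 < 1 := by nlinarith [ht.1, ht.2]
  obtain ⟨l, hl⟩ : ∃ l, l = (1 + |t|) / 2 := ⟨_, rfl⟩
  have hl0 : 0 < l := by rw [hl]; positivity
  have hl1 : l < 1 := by rw [hl]; linarith
  have htl : |t| < l := by rw [hl]; linarith
  have hs : t / l ∈ Ioo (-1 : ℝ) 1 := by
    rw [mem_Ioo, ← abs_lt, abs_div, abs_of_pos hl0]
    exact (div_lt_one hl0).2 htl
  obtain ⟨s, hst⟩ : ∃ s, s = t / l := ⟨_, rfl⟩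
  rw [← hst] at hs
  have hts : t = l * s := by rw [hst]; field_simp
  have hs0 : s ≠ 0 := by
    rintro rfl
    simp at hts
    exact ht0 hts
  obtain ⟨a₁, ⟨ha₁, hmem⟩, -⟩ := h.circle s hs hs0
  rw [mem_H_sqrt_iff ha₁ hs, absSq, div_eq_iff (by positivity)] at hmem
  have hlt : absSq b c t a₁ < 1 - t ^ 2 := by
    rw [absSq, div_lt_iff₀ (by positivity), hts]
    have h1 := h.sq_lt a₁ ha₁
    have h2 : 0 < (1 - l) * (a₁ ^ 2 - b a₁ ^ 2 - c a₁ ^ 2) :=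
      mul_pos (by linarith) (by linarith)
    have h3 : 0 ≤ l * (1 - l) * ((1 + a₁ ^ 2) * s ^ 2) :=
      mul_nonneg (mul_nonneg hl0.le (by linarith)) (by positivity)
    linear_combination h2 + h3 + l * hmem
  obtain ⟨a₂, ha₂, ha21, heq⟩ := h.exists_absSq_eq_of_lt ht0 ha₁ hlt
  filter_upwards [eventually_gt_atTop a₁] with a ha
  by_contra hge
  push Not at hge
  obtain ⟨a₃, ha₃, heq₃⟩ := intermediate_value_Icc ha.le
    ((h.continuousOn_absSq t).mono fun a ha => ha₁.trans_le ha.1) ⟨hlt.le, hge⟩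
  have hpos : 0 < a₃ := ha₁.trans_le ha₃.1
  have := (h.circle t ht ht0).unique ⟨ha₂, (mem_H_sqrt_iff ha₂ ht).2 heq⟩
    ⟨hpos, (mem_H_sqrt_iff hpos ht).2 heq₃⟩
  linarith [ha₃.1]

theorem tendsto_atTop (h : Admissible b c) :
    Tendsto (fun a => (b a ^ 2 + c a ^ 2) / a ^ 2) atTop (𝓝 0) := by
  rw [Metric.tendsto_nhds]
  intro ε hε
  obtain ⟨t, ht0, ht1, ht⟩ : ∃ t : ℝ, 0 < t ∧ t < 1 ∧ 1 - t ^ 2 < ε := by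
    refine ⟨max (1 / 2) (1 - ε / 2), ?_, ?_, ?_⟩
    · exact lt_of_lt_of_le (by norm_num) (le_max_left _ _)
    · exact max_lt (by norm_num) (by linarith)
    · have h1 := le_max_right (1 / 2) (1 - ε / 2)
      have h2 := le_max_left (1 / 2) (1 - ε / 2)
      have h3 : max (1 / 2) (1 - ε / 2) < 1 := max_lt (by norm_num) (by linarith)
      nlinarith
  filter_upwards [h.eventually_absSq_lt (t := t) ⟨by linarith, ht1⟩ ht0.ne',
    h.eventually_absSq_lt (t := -t) ⟨by linarith, by linarith⟩ (by simpa using ht0.ne'),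
    eventually_gt_atTop 0] with a h1 h2 ha
  rw [Real.dist_eq, sub_zero, abs_of_nonneg (by positivity)]
  refine lt_of_le_of_lt ?_ ht
  -- Averaging over the heights `t` and `-t` cancels the term linear in `b a`.
  have h3 : (b a ^ 2 + c a ^ 2) / a ^ 2 =
      (absSq b c t a + absSq b c (-t) a) / 2 - t ^ 2 / a ^ 2 := by
    unfold absSq
    field_simp
    ring
  have h4 : 0 ≤ t ^ 2 / a ^ 2 := by positivity
  rw [h3]
  nlinarith

theorem tendsto_absSq_atTop (h : Admissible b c) (z : ℝ) :
    Tendsto (absSq b c z) atTop (𝓝 0) := by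
  have h1 : Tendsto (fun a : ℝ => 2 * z ^ 2 / a ^ 2 + 2 * ((b a ^ 2 + c a ^ 2) / a ^ 2)) atTop
      (𝓝 (0 + 2 * 0)) :=
    (tendsto_const_nhds.div_atTop (tendsto_pow_atTop two_ne_zero)).add
      (h.tendsto_atTop.const_mul 2)
  rw [mul_zero, add_zero] at h1
  refine squeeze_zero (absSq_nonneg b c z) (fun a => ?_) h1
  rw [absSq, ← mul_div_assoc, ← add_div]
  refine div_le_div_of_nonneg_right ?_ (sq_nonneg a)
  nlinarith [sq_nonneg (z + b a), sq_nonneg (c a)]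

theorem exists_absSq_eq (h : Admissible b c) {z y : ℝ} (hz : z ≠ 0) (hy : 0 < y) :
    ∃ a, 0 < a ∧ absSq b c z a = y := by
  obtain ⟨a₀, h1, h2⟩ :=
    (((h.tendsto_absSq_atTop z).eventually_lt_const hy).and (eventually_gt_atTop 0)).exists
  obtain ⟨a, ha, -, hay⟩ := h.exists_absSq_eq_of_lt hz h2 h1
  exact ⟨a, ha, hay⟩

theorem absSq_inj (h : Admissible b c) {z a a' : ℝ} (hz : z ≠ 0) (ha : 0 < a) (ha' : 0 < a')
    (hsq : 1 ≤ absSq b c z a + z ^ 2) (heq : absSq b c z a = absSq b c z a') : a = a' := by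
  refine h.exterior (Real.sqrt (absSq b c z a)) z (Real.sqrt_nonneg _) hz ?_ a a' ha ha' ?_ ?_
  · rwa [Real.sq_sqrt (absSq_nonneg _ _ _ _)]
  · rw [mem_H_iff ha, Real.sq_sqrt (absSq_nonneg _ _ _ _)]
  · rw [mem_H_iff ha', Real.sq_sqrt (absSq_nonneg _ _ _ _), heq]

/-- This keeps the other lines off the exterior points of `Z`. For `|z| ≥ 1` every point of height
`z` is non-interior, so `absSq b c z` is injective on the positive reals. A zero at `a` would be a
minimum there, and the value `absSq b c z (a + 1) / 2` would be attained on both sides of `a`. -/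
theorem absSq_pos (h : Admissible b c) {z a : ℝ} (hz : 1 ≤ z ^ 2) (ha : 0 < a) :
    0 < absSq b c z a := by
  have hz0 : z ≠ 0 := by
    rintro rfl
    norm_num at hz
  refine lt_of_le_of_ne (absSq_nonneg _ _ _ _) fun h0 => ?_
  have hinj : ∀ {r s : ℝ}, 0 < r → 0 < s → absSq b c z r = absSq b c z s → r = s :=
    fun {r _} hr hs => h.absSq_inj hz0 hr hs (by linarith [absSq_nonneg b c z r])
  have h1 : 0 < absSq b c z (a + 1) := by
    refine lt_of_le_of_ne (absSq_nonneg _ _ _ _) fun h1 => ?_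
    have := hinj ha (by linarith : 0 < a + 1) (h0.symm.trans h1)
    linarith
  obtain ⟨r, hr, heq⟩ := intermediate_value_Icc (by linarith : a ≤ a + 1)
    ((h.continuousOn_absSq z).mono fun r hr => ha.trans_le hr.1)
    (show absSq b c z (a + 1) / 2 ∈ _ from ⟨by linarith, by linarith⟩)
  obtain ⟨s, hs, hsa, heq'⟩ := h.exists_absSq_eq_of_lt hz0 ha
    (show absSq b c z a < absSq b c z (a + 1) / 2 by linarith)
  have := hinj hs (ha.trans_le hr.1) (heq'.trans heq.symm)
  linarith [hr.1]

end Admissible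

/-! ### From profiles to gl stars -/

/-- Two functions `b`, `σ` describe a family of lines `genLine θ a (b a) (σ a)`, `0 ≤ a`; the lines
of slope `a` have ordinate `b a` at their least distance `|σ a|` from the `z`-axis. -/
structure Profile (b σ : ℝ → ℝ) : Prop where
  continuousOn_b : ContinuousOn b (Ici 0)
  continuousOn_σ : ContinuousOn σ (Ici 0)
  b_zero : b 0 = 0
  σ_zero : σ 0 = 0
  sq_lt : ∀ a, 0 < a → b a ^ 2 + (a * σ a) ^ 2 < a ^ 2

/-- The set of lines described by a profile. -/
def profileStar (b σ : ℝ → ℝ) : Set Line :=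
  {L | L = zAxis ∨ ∃ a : ℝ, 0 ≤ a ∧ ∃ θ : ℝ, L = genLine θ a (b a) (σ a)}

/-- The lines of the profile cover every point outside the open ball exactly once. -/
structure CoveringProfile (b σ : ℝ → ℝ) : Prop extends Profile b σ where
  tendsto_b : Tendsto (fun a => b a / a) atTop (𝓝 0)
  tendsto_σ : Tendsto σ atTop (𝓝 0)
  exists_slope : ∀ z r : ℝ, z ≠ 0 → 0 < r → ∃ a, 0 < a ∧ ((z - b a) / a) ^ 2 + σ a ^ 2 = r
  slope_inj : ∀ z r a a' : ℝ, z ≠ 0 → 1 ≤ r + z ^ 2 → 0 < a → 0 < a' →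
    ((z - b a) / a) ^ 2 + σ a ^ 2 = r → ((z - b a') / a') ^ 2 + σ a' ^ 2 = r → a = a'
  pos : ∀ z a : ℝ, 1 ≤ z ^ 2 → 0 < a → 0 < ((z - b a) / a) ^ 2 + σ a ^ 2

theorem genLine_congr {θ θ' a b σ : ℝ} (hc : Real.cos θ = Real.cos θ')
    (hs : Real.sin θ = Real.sin θ') : genLine θ a b σ = genLine θ' a b σ := by
  simp only [genLine, hc, hs]

theorem linearIndependent_origin {v : E} (h : ¬ (v 0 = 0 ∧ v 1 = 0)) :
    LinearIndependent ℝ ![(!₂[0, 0, 0, 1] : E), v] := by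
  rw [LinearIndependent.pair_iff]
  intro s t hst
  have h0 := congrArg (fun v : E => v 0) hst
  have h1 := congrArg (fun v : E => v 1) hst
  have h3 := congrArg (fun v : E => v 3) hst
  simp at h0 h1 h3
  have ht : t = 0 := by
    by_contra ht
    exact h ⟨h0.resolve_left ht, h1.resolve_left ht⟩
  subst ht
  simpa using h3

theorem isTwoSecant_genLine {θ a b σ : ℝ} (ha : 0 < a) (h : b ^ 2 + (a * σ) ^ 2 < a ^ 2) :
    IsTwoSecant (genLine θ a b σ) := by
  have hcs := Real.sin_sq_add_cos_sq θ
  -- The intersection with the plane `z = 0`, at squared distance `σ² + (b/a)² < 1` from the origin.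
  refine isTwoSecant_of_qf_neg (x := !₂[Real.sin θ * σ - b / a * Real.cos θ,
    -(Real.cos θ * σ) - b / a * Real.sin θ, 0, 1]) ?_ ?_
  · rw [mem_genLine]
    refine ⟨-(b / a), by simp; ring, by simp; ring, ?_⟩
    simp
    field_simp
    ring
  · have h1 : σ ^ 2 + (b / a) ^ 2 < 1 := by
      have : σ ^ 2 + (b / a) ^ 2 = (b ^ 2 + (a * σ) ^ 2) / a ^ 2 := by
        field_simp
        ring
      rw [this, div_lt_one (by positivity)]
      exact h
    simp [qf]
    linear_combination h1 + (σ ^ 2 + (b / a) ^ 2) * hcs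

namespace Profile

variable {b σ : ℝ → ℝ}

theorem isTwoSecant (h : Profile b σ) {L : Line} (hL : L ∈ profileStar b σ) : IsTwoSecant L := by
  rcases hL with rfl | ⟨a, ha, θ, rfl⟩
  · refine isTwoSecant_of_qf_neg (x := !₂[0, 0, 0, 1]) ?_ (by simp [qf])
    rw [mem_zAxis]
    simp
  · rcases ha.eq_or_lt with rfl | ha
    · refine isTwoSecant_of_qf_neg (x := !₂[0, 0, 0, 1]) ?_ (by simp [qf])
      rw [mem_genLine]
      exact ⟨0, by simp [h.b_zero, h.σ_zero]⟩
    · exact isTwoSecant_genLine ha (h.sq_lt a ha)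

theorem rotGr_mem {L : Line} (hL : L ∈ profileStar b σ) (φ : ℝ) :
    rotGr φ L ∈ profileStar b σ := by
  rcases hL with rfl | ⟨a, ha, θ, rfl⟩
  · exact Or.inl (rotGr_zAxis φ)
  · exact Or.inr ⟨a, ha, φ + θ, rotGr_genLine _ _ _ _ _⟩

theorem xAxis_mem (h : Profile b σ) : xAxis ∈ profileStar b σ := by
  refine Or.inr ⟨0, le_rfl, 0, ?_⟩
  rw [h.b_zero, h.σ_zero, genLine_zero]

theorem not_mem_plane (h : Profile b σ) {a r : ℝ} (ha : 0 < a) (hr : 1 ≤ r) :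
    ((0 - b a) / a) ^ 2 + σ a ^ 2 ≠ r := by
  intro heq
  have h1 := h.sq_lt a ha
  have h2 : ((0 - b a) / a) ^ 2 + σ a ^ 2 = (b a ^ 2 + (a * σ a) ^ 2) / a ^ 2 := by
    field_simp
    ring
  rw [h2, div_eq_iff (by positivity)] at heq
  nlinarith [sq_nonneg a]

end Profile

theorem sq_add_sq_of_mem_genLine {θ t x y w s : ℝ}
    (h0 : x = w * (Real.sin θ * s) + t * Real.cos θ)
    (h1 : y = -(w * (Real.cos θ * s)) + t * Real.sin θ) :
    x ^ 2 + y ^ 2 = t ^ 2 + (w * s) ^ 2 := by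
  rw [h0, h1]
  linear_combination (t ^ 2 + (w * s) ^ 2) * Real.sin_sq_add_cos_sq θ

namespace CoveringProfile

variable {b σ : ℝ → ℝ}

theorem exists_mem (h : CoveringProfile b σ) (v : E) : ∃ L ∈ profileStar b σ, v ∈ L.1 := by
  by_cases h01 : v 0 = 0 ∧ v 1 = 0
  · exact ⟨zAxis, Or.inl rfl, mem_zAxis.2 h01⟩
  have hpos : 0 < v 0 ^ 2 + v 1 ^ 2 := by
    by_contra hneg
    exact h01 ⟨by nlinarith [sq_nonneg (v 0), sq_nonneg (v 1)],
      by nlinarith [sq_nonneg (v 0), sq_nonneg (v 1)]⟩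
  -- By rotation, only the height of the point and its distance from `Z` matter.
  suffices ∃ a, 0 ≤ a ∧ ∃ t, v 2 = v 3 * b a + t * a ∧
      v 0 ^ 2 + v 1 ^ 2 = t ^ 2 + (-(v 3 * σ a)) ^ 2 by
    obtain ⟨a, ha, t, h2, hsq⟩ := this
    obtain ⟨θ, h0, h1⟩ := exists_rotation hsq
    refine ⟨_, Or.inr ⟨a, ha, θ, rfl⟩, mem_genLine.2 ⟨t, ?_, ?_, h2⟩⟩
    · rw [h0]
      ring
    · rw [h1]
      ring
  set r := Real.sqrt (v 0 ^ 2 + v 1 ^ 2) with hr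
  have hr0 : 0 < r := Real.sqrt_pos.2 hpos
  have hr2 : r ^ 2 = v 0 ^ 2 + v 1 ^ 2 := Real.sq_sqrt hpos.le
  by_cases h2 : v 2 = 0
  · exact ⟨0, le_rfl, r, by simp [h2, h.b_zero], by simp [h.σ_zero, hr2]⟩
  by_cases h3 : v 3 = 0
  -- At infinity the direction prescribes the slope. Since slopes are nonnegative, the sign of `v 2`
  -- goes into `t`.
  · rcases le_total 0 (v 2) with h2' | h2'
    · refine ⟨v 2 / r, by positivity, r, ?_, by simp [h3, hr2]⟩
      rw [h3]
      field_simp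
      ring
    · refine ⟨-v 2 / r, div_nonneg (by linarith) hr0.le, -r, ?_, by simp [h3, hr2]⟩
      rw [h3]
      field_simp
      ring
  · obtain ⟨a, ha, heq⟩ := h.exists_slope (v 2 / v 3) ((v 0 ^ 2 + v 1 ^ 2) / v 3 ^ 2)
      (div_ne_zero h2 h3) (by positivity)
    refine ⟨a, ha.le, (v 2 - v 3 * b a) / a, ?_, ?_⟩
    · field_simp
      ring
    · rw [eq_div_iff (by positivity)] at heq
      rw [← heq]
      field_simp

/-- The point determines, in this order, whether the line is `Z`, whether it is horizontal, its
slope, and finally the angle. -/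
theorem unique_mem (h : CoveringProfile b σ) {v : E} (hv : v ≠ 0) (hq : 0 ≤ qf v) {L L' : Line}
    (hL : L ∈ profileStar b σ) (hL' : L' ∈ profileStar b σ) (hvL : v ∈ L.1) (hvL' : v ∈ L'.1) :
    L = L' := by
  have hslope : ∀ {a t : ℝ}, 0 < a → v 3 ≠ 0 →
      v 0 ^ 2 + v 1 ^ 2 = t ^ 2 + (v 3 * σ a) ^ 2 → v 2 = v 3 * b a + t * a →
      ((v 2 / v 3 - b a) / a) ^ 2 + σ a ^ 2 = (v 0 ^ 2 + v 1 ^ 2) / v 3 ^ 2 := by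
    intro a t ha h3 hsq h2
    rw [hsq, h2]
    field_simp
    ring
  have hq' : v 3 ≠ 0 → 1 ≤ (v 0 ^ 2 + v 1 ^ 2) / v 3 ^ 2 + (v 2 / v 3) ^ 2 := by
    intro h3
    have : (v 0 ^ 2 + v 1 ^ 2) / v 3 ^ 2 + (v 2 / v 3) ^ 2 =
        (v 0 ^ 2 + v 1 ^ 2 + v 2 ^ 2) / v 3 ^ 2 := by
      field_simp
    rw [this, one_le_div (by positivity)]
    simp only [qf] at hq
    linarith
  have hZ : ∀ {a θ : ℝ}, 0 ≤ a → v ∈ (genLine θ a (b a) (σ a)).1 → ¬ (v 0 = 0 ∧ v 1 = 0) := by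
    rintro a θ ha hm ⟨h0, h1⟩
    obtain ⟨t, e0, e1, e2⟩ := mem_genLine.1 hm
    have hsq := sq_add_sq_of_mem_genLine e0 e1
    rw [h0, h1] at hsq
    have ht : t = 0 := by nlinarith [sq_nonneg t, sq_nonneg (v 3 * σ a)]
    by_cases h3 : v 3 = 0
    · apply hv
      apply ext_coords <;> simp [h0, h1, h3, e2, ht]
    · rcases ha.eq_or_lt with rfl | ha
      · have h2 : v 2 = 0 := by simp [e2, h.b_zero]
        simp only [qf, h0, h1, h2] at hq
        have : 0 < v 3 ^ 2 := by positivity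
        linarith
      · have h4 := hslope ha h3 (by rw [h0, h1, hsq]) e2
        have h5 := hq' h3
        have h6 : (v 0 ^ 2 + v 1 ^ 2) / v 3 ^ 2 = 0 := by simp [h0, h1]
        rw [h6] at h4 h5
        rw [zero_add] at h5
        exact (h.pos (v 2 / v 3) a h5 ha).ne' h4
  have hplane : ∀ {a θ : ℝ}, 0 < a → v ∈ (genLine θ a (b a) (σ a)).1 → v 3 ≠ 0 → v 2 ≠ 0 := by
    intro a θ ha hm h3 h2
    obtain ⟨t, e0, e1, e2⟩ := mem_genLine.1 hm
    have hsq := sq_add_sq_of_mem_genLine e0 e1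
    have h4 := hslope ha h3 hsq e2
    have h5 := hq' h3
    rw [h2, zero_div] at h4 h5
    exact h.not_mem_plane ha (by simpa using h5) h4
  rcases hL with rfl | ⟨a, ha, θ, rfl⟩
  · rcases hL' with rfl | ⟨a', ha', θ', rfl⟩
    · rfl
    · exact absurd (mem_zAxis.1 hvL) (hZ ha' hvL')
  · rcases hL' with rfl | ⟨a', ha', θ', rfl⟩
    · exact absurd (mem_zAxis.1 hvL') (hZ ha hvL)
    · have hne := hZ ha hvL
      obtain ⟨t, e0, e1, e2⟩ := mem_genLine.1 hvL
      obtain ⟨t', e0', e1', e2'⟩ := mem_genLine.1 hvL'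
      have hsq := sq_add_sq_of_mem_genLine e0 e1
      have hsq' := sq_add_sq_of_mem_genLine e0' e1'
      have hpos : 0 < v 0 ^ 2 + v 1 ^ 2 := by
        by_contra hneg
        exact hne ⟨by nlinarith [sq_nonneg (v 0), sq_nonneg (v 1)],
          by nlinarith [sq_nonneg (v 0), sq_nonneg (v 1)]⟩
      have haa : a = a' := by
        by_cases h3 : v 3 = 0
        · rw [h3, zero_mul, zero_add] at e2 e2'
          rw [h3, zero_mul] at hsq hsq'
          have ht : t ^ 2 = t' ^ 2 := by linarith
          have ht0 : t ^ 2 ≠ 0 := by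
            intro h0
            rw [h0] at hsq
            linarith
          have : t ^ 2 * a ^ 2 = t ^ 2 * a' ^ 2 := by
            rw [← mul_pow, ← e2, e2', ht]
            ring
          exact (sq_eq_sq₀ ha ha').1 (mul_left_cancel₀ ht0 this)
        · rcases ha.eq_or_lt with rfl | ha0
          · rcases ha'.eq_or_lt with rfl | ha0'
            · rfl
            · exact absurd (by simpa [h.b_zero] using e2) (hplane ha0' hvL' h3)
          · rcases ha'.eq_or_lt with rfl | ha0'
            · exact absurd (by simpa [h.b_zero] using e2') (hplane ha0 hvL h3)
            · exact h.slope_inj (v 2 / v 3) _ a a' (div_ne_zero (hplane ha0 hvL h3) h3) (hq' h3)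
                ha0 ha0' (hslope ha0 h3 hsq e2) (hslope ha0' h3 hsq' e2')
      subst haa
      rcases ha.eq_or_lt with rfl | ha
      -- Horizontal lines all pass through the origin, which is a second common point.
      · have hO : ∀ φ : ℝ, (!₂[0, 0, 0, 1] : E) ∈ (genLine φ 0 (b 0) (σ 0)).1 := fun φ =>
          mem_genLine.2 ⟨0, by simp [h.b_zero, h.σ_zero]⟩
        exact line_eq_of_mem (linearIndependent_origin hne) (hO _) hvL (hO _) hvL'
      · have ht : t = t' := by
          have : t * a = t' * a := by linarith
          exact mul_right_cancel₀ ha.ne' this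
        subst ht
        -- Both rotations carry the same nonzero vector `(t, -v 3 * σ a)` to `(v 0, v 1)`, so their
        -- cosines and sines agree.
        have hD : t ^ 2 + (v 3 * σ a) ^ 2 ≠ 0 := by
          rw [← hsq]
          exact hpos.ne'
        apply genLine_congr
        · apply mul_left_cancel₀ hD
          linear_combination t * (e0' - e0) - v 3 * σ a * (e1' - e1)
        · apply mul_left_cancel₀ hD
          linear_combination t * (e1' - e1) + v 3 * σ a * (e0' - e0)

end CoveringProfile

/-! ### Compactness of the line set and continuity of the star -/

theorem continuous_genLine :
    Continuous fun x : ℝ × ℝ × ℝ × ℝ => genLine x.1 x.2.1 x.2.2.1 x.2.2.2 :=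
  continuous_lineOf (by fun_prop) (by fun_prop) _

theorem tendsto_genLine {b σ : ℝ → ℝ} {l : Filter ℝ} {a₀ b₀ σ₀ : ℝ} (θ : ℝ)
    (ha : Tendsto (fun a : ℝ => a) l (𝓝 a₀))
    (h : Tendsto (fun a => (b a, σ a)) l (𝓝 (b₀, σ₀))) :
    Tendsto (fun a => genLine θ a (b a) (σ a)) l (𝓝 (genLine θ a₀ b₀ σ₀)) := by
  have h1 : Tendsto (fun a => (θ, a, b a, σ a)) l (𝓝 (θ, a₀, b₀, σ₀)) :=
    tendsto_const_nhds.prodMk_nhds (ha.prodMk_nhds h)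
  have h2 := continuous_genLine.tendsto (θ, a₀, b₀, σ₀)
  dsimp only at h2
  exact Tendsto.comp (f := fun a => (θ, a, b a, σ a)) h2 h1

theorem linearIndependent_steepLine (θ m β σ : ℝ) :
    LinearIndependent ℝ ![(!₂[Real.sin θ * σ - β * Real.cos θ,
      -(Real.cos θ * σ) - β * Real.sin θ, 0, 1] : E), !₂[m * Real.cos θ, m * Real.sin θ, 1, 0]] := by
  rw [LinearIndependent.pair_iff]
  intro s t h
  have h2 := congrArg (fun v : E => v 2) h
  have h3 := congrArg (fun v : E => v 3) h
  simp at h2 h3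
  exact ⟨h3, h2⟩

/-- The line `x + i y = exp (i θ) (m z - β - i σ)`. -/
def steepLine (θ m β σ : ℝ) : Line := lineOf _ _ (linearIndependent_steepLine θ m β σ)

theorem continuous_steepLine :
    Continuous fun x : ℝ × ℝ × ℝ × ℝ => steepLine x.1 x.2.1 x.2.2.1 x.2.2.2 :=
  continuous_lineOf (by fun_prop) (by fun_prop) _

/-- The coordinates `m = 1/a` and `β = b/a` stay regular as the slope tends to infinity; `Z` appears
at `m = 0`. -/
theorem genLine_eq_steepLine {θ m b σ : ℝ} (hm : 0 < m) :
    genLine θ m⁻¹ b σ = steepLine θ m (m * b) σ := by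
  apply line_eq_lineOf <;> rw [mem_genLine]
  · refine ⟨-(m * b), by simp; ring, by simp; ring, ?_⟩
    simp
    field_simp
    ring
  · refine ⟨m, by simp, by simp, ?_⟩
    simp
    field_simp

theorem zAxis_eq_steepLine (θ : ℝ) : zAxis = steepLine θ 0 0 0 := by
  apply line_eq_lineOf <;> rw [mem_zAxis] <;> simp

theorem exists_angle_mem_Icc (θ : ℝ) : ∃ φ ∈ Icc (-Real.pi) Real.pi,
    Real.cos θ = Real.cos φ ∧ Real.sin θ = Real.sin φ := by
  have hn : ‖(⟨Real.cos θ, Real.sin θ⟩ : ℂ)‖ = 1 := by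
    rw [← sq_eq_sq₀ (norm_nonneg _) zero_le_one, Complex.sq_norm, Complex.normSq_mk]
    linear_combination Real.sin_sq_add_cos_sq θ
  refine ⟨Complex.arg ⟨Real.cos θ, Real.sin θ⟩,
    ⟨(Complex.neg_pi_lt_arg _).le, Complex.arg_le_pi _⟩, ?_, ?_⟩
  · have := Complex.norm_mul_cos_arg ⟨Real.cos θ, Real.sin θ⟩
    rw [hn, one_mul] at this
    exact this.symm
  · have := Complex.norm_mul_sin_arg ⟨Real.cos θ, Real.sin θ⟩
    rw [hn, one_mul] at this
    exact this.symm

/-- If `f` is continuous on `[0, ∞[` and `f → 0` at infinity, then `m ↦ f (1 / m)` extends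
continuously to `m = 0`. -/
theorem continuousOn_comp_inv {f : ℝ → ℝ} (hf : ContinuousOn f (Ioi 0))
    (hlim : Tendsto f atTop (𝓝 0)) (h0 : f 0 = 0) :
    ContinuousOn (fun m => f m⁻¹) (Ici 0) := by
  intro m hm
  rcases (mem_Ici.1 hm).eq_or_lt with rfl | hm
  -- The convention `0⁻¹ = 0` makes `f 0` the value at `m = 0`, which is why `f 0 = 0` is required.
  · rw [← continuousWithinAt_Ioi_iff_Ici, ContinuousWithinAt, inv_zero, h0]
    exact hlim.comp tendsto_inv_nhdsGT_zero
  · have h1 : ContinuousAt f m⁻¹ := hf.continuousAt (Ioi_mem_nhds (inv_pos.2 hm))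
    exact (h1.comp (continuousAt_inv₀ hm.ne')).continuousWithinAt

namespace CoveringProfile

variable {b σ : ℝ → ℝ}

/-- Two continuous images of a compact rectangle cover the set: slopes at most 1 through `genLine`,
and slopes at least 1 together with `Z` through `steepLine`. -/
theorem isCompact_profileStar (h : CoveringProfile b σ) : IsCompact (profileStar b σ) := by
  have hK : IsCompact (Icc (0 : ℝ) 1 ×ˢ Icc (-Real.pi) Real.pi) := isCompact_Icc.prod isCompact_Icc
  have hfst : MapsTo (Prod.fst : ℝ × ℝ → ℝ) (Icc (0 : ℝ) 1 ×ˢ Icc (-Real.pi) Real.pi) (Ici 0) :=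
    fun x hx => hx.1.1
  have h1 : IsCompact ((fun x : ℝ × ℝ => genLine x.2 x.1 (b x.1) (σ x.1)) ''
      (Icc (0 : ℝ) 1 ×ˢ Icc (-Real.pi) Real.pi)) := by
    refine hK.image_of_continuousOn ?_
    have hb := h.continuousOn_b.comp continuousOn_fst hfst
    have hσ := h.continuousOn_σ.comp continuousOn_fst hfst
    exact continuous_genLine.comp_continuousOn (f := fun x : ℝ × ℝ => (x.2, x.1, b x.1, σ x.1))
      (continuousOn_snd.prodMk (continuousOn_fst.prodMk (hb.prodMk hσ)))
  have h2 : IsCompact ((fun x : ℝ × ℝ => steepLine x.2 x.1 (x.1 * b x.1⁻¹) (σ x.1⁻¹)) ''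
      (Icc (0 : ℝ) 1 ×ˢ Icc (-Real.pi) Real.pi)) := by
    refine hK.image_of_continuousOn ?_
    have hb : ContinuousOn (fun m : ℝ => m * b m⁻¹) (Ici 0) := by
      have h3 := continuousOn_comp_inv (f := fun a => b a / a)
        ((h.continuousOn_b.mono Ioi_subset_Ici_self).div continuousOn_id fun a ha => ne_of_gt ha)
        h.tendsto_b (by simp)
      refine h3.congr fun m _ => ?_
      simp [mul_comm]
    have hσ := continuousOn_comp_inv (h.continuousOn_σ.mono Ioi_subset_Ici_self) h.tendsto_σ
      h.σ_zero
    exact continuous_steepLine.comp_continuousOn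
      (f := fun x : ℝ × ℝ => (x.2, x.1, x.1 * b x.1⁻¹, σ x.1⁻¹))
      (continuousOn_snd.prodMk (continuousOn_fst.prodMk
        ((hb.comp continuousOn_fst hfst).prodMk (hσ.comp continuousOn_fst hfst))))
  convert h1.union h2 using 1
  ext L
  constructor
  · rintro (rfl | ⟨a, ha, θ, rfl⟩)
    · refine Or.inr ⟨(0, 0), ⟨by simp, by simp [Real.pi_pos.le]⟩, ?_⟩
      simp [h.σ_zero, ← zAxis_eq_steepLine]
    · obtain ⟨φ, hφ, hc, hs⟩ := exists_angle_mem_Icc θ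
      rw [genLine_congr hc hs]
      rcases le_total a 1 with h1 | h1
      · exact Or.inl ⟨(a, φ), ⟨⟨ha, h1⟩, hφ⟩, rfl⟩
      · have ha0 : 0 < a := by linarith
        refine Or.inr ⟨(a⁻¹, φ), ⟨⟨by positivity, inv_le_one_of_one_le₀ h1⟩, hφ⟩, ?_⟩
        have := genLine_eq_steepLine (θ := φ) (b := b a) (σ := σ a) (inv_pos.2 ha0)
        rw [inv_inv] at this
        simp only [inv_inv, this]
  · rintro (⟨⟨a, θ⟩, ⟨⟨ha, -⟩, -⟩, rfl⟩ | ⟨⟨m, θ⟩, ⟨⟨hm, -⟩, -⟩, rfl⟩)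
    · exact Or.inr ⟨a, ha, θ, rfl⟩
    · rcases (show (0 : ℝ) ≤ m from hm).eq_or_lt with rfl | hm
      · left
        simp [h.σ_zero, ← zAxis_eq_steepLine]
      · exact Or.inr ⟨m⁻¹, by positivity, θ, (genLine_eq_steepLine hm).symm⟩

theorem isGlStar (h : CoveringProfile b σ) : IsGlStar (profileStar b σ) where
  two_secant _ hL := h.isTwoSecant hL
  existsUnique_line p hp := by
    obtain ⟨v, hv, rfl⟩ := exists_eq_pointOf p
    rw [isInterior_iff, not_lt] at hp
    obtain ⟨L, hL, hvL⟩ := h.exists_mem v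
    refine ⟨L, ⟨hL, incident_pointOf.2 hvL⟩, ?_⟩
    rintro L' ⟨hL', hvL'⟩
    exact h.unique_mem hv hp hL' hL (incident_pointOf.1 hvL') hvL

end CoveringProfile

/-- A compact gl star is topological. -/
theorem IsGlStar.isTopological {S : Set Line} (h : IsGlStar S) (hS : IsCompact S) :
    IsTopologicalGlStar S where
  toIsGlStar := h
  continuous_line := by
    choose f hf hu using fun p : {p : Point // ¬ IsInterior p} => h.existsUnique_line p.1 p.2
    refine ⟨f, ?_, hf⟩
    rw [continuous_iff_isClosed]
    intro C hC
    have : CompactSpace S := isCompact_iff_compactSpace.1 hS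
    -- By uniqueness of the star line, the preimage of `C` is the projection of this closed set
    -- along the compact factor `S`.
    have hcl : IsClosed {x : {p : Point // ¬ IsInterior p} × S |
        Incident x.1.1 x.2.1 ∧ x.2.1 ∈ C} := by
      refine IsClosed.and ?_ ?_
      · exact isClosed_incident.preimage ((continuous_subtype_val.comp continuous_fst).prodMk
          (continuous_subtype_val.comp continuous_snd))
      · exact hC.preimage (continuous_subtype_val.comp continuous_snd)
    convert isClosedMap_fst_of_compactSpace _ hcl using 1
    ext p
    constructor
    · intro hp
      exact ⟨(p, ⟨f p, (hf p).1⟩), ⟨(hf p).2, hp⟩, rfl⟩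
    · rintro ⟨⟨p, L, hL⟩, ⟨hi, hC⟩, rfl⟩
      rw [mem_preimage, ← hu p L ⟨hL, hi⟩]
      exact hC

theorem CoveringProfile.isTopologicalRotationalGlStar {b σ : ℝ → ℝ} (h : CoveringProfile b σ) :
    IsTopologicalRotationalGlStarInStandardPosition (profileStar b σ) where
  toIsTopologicalGlStar := h.isGlStar.isTopological h.isCompact_profileStar
  rotational θ _ hL := Profile.rotGr_mem hL θ
  xAxis_mem := h.xAxis_mem

/-! ### Admissible families yield gl stars -/

theorem star_eq_profileStar {b c b' σ : ℝ → ℝ} {ε : ℝ → Hand} (hc : ∀ a, 0 < a → 0 ≤ c a)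
    (hb : ∀ a, 0 < a → b' a = b a) (hσ : ∀ a, 0 < a → σ a = (ε a).sign * (c a / a))
    (hb0 : b' 0 = 0) (hσ0 : σ 0 = 0) : star b c ε = profileStar b' σ := by
  ext L
  constructor
  · rintro (((rfl | ⟨θ, rfl⟩) | ⟨a, ha, h0, hL⟩) | ⟨a, ha, h0, hL⟩)
    · exact Or.inl rfl
    · exact Or.inr ⟨0, le_rfl, θ, by rw [rotGr_xAxis, hb0, hσ0]⟩
    · obtain ⟨θ, rfl⟩ := (mem_cone_or_regulus_iff ha (hc a ha) (ε a)).1 (Or.inl ⟨h0, hL⟩)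
      exact Or.inr ⟨a, ha.le, θ, by rw [hb a ha, hσ a ha]⟩
    · obtain ⟨θ, rfl⟩ := (mem_cone_or_regulus_iff ha (hc a ha) (ε a)).1 (Or.inr ⟨h0, hL⟩)
      exact Or.inr ⟨a, ha.le, θ, by rw [hb a ha, hσ a ha]⟩
  · rintro (rfl | ⟨a, ha, θ, rfl⟩)
    · exact Or.inl (Or.inl (Or.inl rfl))
    · rcases ha.eq_or_lt with rfl | ha
      · exact Or.inl (Or.inl (Or.inr ⟨θ, by rw [rotGr_xAxis, hb0, hσ0]⟩))
      · rw [hb a ha, hσ a ha]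
        rcases (mem_cone_or_regulus_iff ha (hc a ha) (ε a)).2 ⟨θ, rfl⟩ with h | h
        · exact Or.inl (Or.inr ⟨a, ha, h⟩)
        · exact Or.inr ⟨a, ha, h⟩

theorem Hand.abs_sign (h : Hand) : |h.sign| = 1 := by
  cases h <;> simp [Hand.sign]

theorem continuousOn_extend_zero {f : ℝ → ℝ} (hf : ContinuousOn f (Ioi 0))
    (h0 : Tendsto f (𝓝[>] 0) (𝓝 0)) :
    ContinuousOn (fun a => if 0 < a then f a else 0) (Ici 0) := by
  intro a ha
  rcases (mem_Ici.1 ha).eq_or_lt with rfl | ha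
  · rw [← continuousWithinAt_Ioi_iff_Ici, ContinuousWithinAt, if_neg (lt_irrefl 0)]
    refine h0.congr' ?_
    filter_upwards [self_mem_nhdsWithin] with a ha
    rw [if_pos (mem_Ioi.1 ha)]
  · refine ContinuousAt.continuousWithinAt ?_
    refine (hf.continuousAt (Ioi_mem_nhds ha)).congr ?_
    filter_upwards [Ioi_mem_nhds ha] with a ha
    rw [if_pos (mem_Ioi.1 ha)]

/-- The sign can jump only at zeros of `c`, where the product tends to 0 regardless of sign.
Elsewhere the hand is locally constant. -/
theorem continuousOn_sign_mul {c : ℝ → ℝ} {ε : ℝ → Hand} (hc : ContinuousOn c (Ioi 0))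
    (hε : AdmissibleChoice c ε) :
    ContinuousOn (fun a => (ε a).sign * (c a / a)) (Ioi 0) := by
  have hdiv : ContinuousOn (fun a => c a / a) (Ioi 0) :=
    hc.div continuousOn_id fun a ha => ne_of_gt ha
  intro a ha
  refine ContinuousAt.continuousWithinAt ?_
  have hcont : ContinuousAt (fun a => c a / a) a := hdiv.continuousAt (Ioi_mem_nhds ha)
  by_cases h0 : c a = 0
  · have h1 : Tendsto (fun a => c a / a) (𝓝 a) (𝓝 0) := by
      have := hcont.tendsto
      rwa [h0, zero_div] at this
    rw [ContinuousAt, h0, zero_div, mul_zero, tendsto_zero_iff_abs_tendsto_zero]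
    refine (tendsto_zero_iff_abs_tendsto_zero _).1 h1 |>.congr fun r => ?_
    simp [abs_mul, Hand.abs_sign]
  · have hev : ∀ᶠ r in 𝓝 a, c r ≠ 0 ∧ 0 < r :=
      ((hc.continuousAt (Ioi_mem_nhds ha)).eventually_ne h0).and (Ioi_mem_nhds ha)
    obtain ⟨δ, hδ, hball⟩ := Metric.eventually_nhds_iff_ball.1 hev
    have hconst : ∀ᶠ r in 𝓝 a, ε r = ε a := by
      filter_upwards [Metric.ball_mem_nhds a hδ] with r hr
      have hsub : ∀ s, s ∈ uIcc a r → s ∈ Metric.ball a δ := by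
        intro s hs
        have := convex_ball a δ
        rw [convex_iff_segment_subset] at this
        exact this (Metric.mem_ball_self hδ) hr (by rwa [segment_eq_uIcc])
      rcases le_total a r with har | har
      · rw [uIcc_of_le har] at hsub
        exact (hε a r ha har fun s hs => (hball s (hsub s hs)).1).symm
      · rw [uIcc_of_ge har] at hsub
        exact hε r a (hball r hr).2 har fun s hs => (hball s (hsub s hs)).1
    refine ContinuousAt.congr (hcont.const_mul (ε a).sign) ?_
    filter_upwards [hconst] with r hr
    rw [hr]

theorem Admissible.coveringProfile {b c : ℝ → ℝ} {ε : ℝ → Hand} (h : Admissible b c)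
    (hε : AdmissibleChoice c ε) :
    CoveringProfile (fun a => if 0 < a then b a else 0)
      (fun a => if 0 < a then (ε a).sign * (c a / a) else 0) := by
  have hs : ∀ a, (ε a).sign ^ 2 = 1 := fun a => by rw [← sq_abs, Hand.abs_sign, one_pow]
  have hσ0 : Tendsto (fun a => (ε a).sign * (c a / a)) (𝓝[>] 0) (𝓝 0) := by
    rw [tendsto_zero_iff_abs_tendsto_zero]
    refine (tendsto_zero_iff_abs_tendsto_zero _).1 h.tendsto_c_div |>.congr fun r => ?_
    simp [abs_mul, Hand.abs_sign]
  have habs : ∀ z a, 0 < a → ((z - (if 0 < a then b a else 0)) / a) ^ 2 +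
      (if 0 < a then (ε a).sign * (c a / a) else 0) ^ 2 = absSq b c z a := by
    intro z a ha
    rw [if_pos ha, if_pos ha, mul_pow, hs, absSq]
    field_simp
  have hsqrt : ∀ {f g : ℝ → ℝ}, (∀ᶠ a in atTop, f a ^ 2 ≤ g a) → Tendsto g atTop (𝓝 0) →
      Tendsto f atTop (𝓝 0) := by
    intro f g hfg hg
    have h1 : Tendsto (fun a => f a ^ 2) atTop (𝓝 0) :=
      squeeze_zero' (Eventually.of_forall fun a => sq_nonneg _) hfg hg
    have h2 := h1.sqrt
    rw [Real.sqrt_zero] at h2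
    rw [tendsto_zero_iff_abs_tendsto_zero]
    exact h2.congr fun a => Real.sqrt_sq_eq_abs _
  refine ⟨⟨?_, ?_, ?_, ?_, ?_⟩, ?_, ?_, ?_, ?_, ?_⟩
  · exact continuousOn_extend_zero h.continuousOn_b h.tendsto_b
  · exact continuousOn_extend_zero (continuousOn_sign_mul h.continuousOn_c hε) hσ0
  · simp
  · simp
  · intro a ha
    have h1 := h.sq_lt a ha
    rw [if_pos ha, if_pos ha, mul_pow, mul_pow, hs, one_mul, ← mul_pow, mul_div_cancel₀ _ ha.ne']
    exact h1
  · refine hsqrt ?_ h.tendsto_atTop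
    filter_upwards [eventually_gt_atTop 0] with a ha
    rw [if_pos ha, div_pow]
    gcongr
    linarith [sq_nonneg (c a)]
  · refine hsqrt ?_ h.tendsto_atTop
    filter_upwards [eventually_gt_atTop 0] with a ha
    rw [if_pos ha, mul_pow, hs, one_mul, div_pow]
    gcongr
    linarith [sq_nonneg (b a)]
  · intro z r hz hr
    obtain ⟨a, ha, heq⟩ := h.exists_absSq_eq hz hr
    exact ⟨a, ha, (habs z a ha).trans heq⟩
  · intro z r a a' hz hr ha ha' h1 h2
    rw [habs z a ha] at h1
    rw [habs z a' ha'] at h2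
    exact h.absSq_inj hz ha ha' (by rwa [h1]) (h1.trans h2.symm)
  · intro z a hz ha
    rw [habs z a ha]
    exact h.absSq_pos hz ha

theorem Admissible.isTopologicalRotationalGlStar {b c : ℝ → ℝ} {ε : ℝ → Hand}
    (h : Admissible b c) (hε : AdmissibleChoice c ε) :
    IsTopologicalRotationalGlStarInStandardPosition (star b c ε) := by
  rw [star_eq_profileStar (b' := fun a => if 0 < a then b a else 0)
    (σ := fun a => if 0 < a then (ε a).sign * (c a / a) else 0) h.c_nonneg
    (fun a ha => if_pos ha) (fun a ha => if_pos ha) (by simp) (by simp)]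
  exact (h.coveringProfile hε).isTopologicalRotationalGlStar

/-! ### Every gl star comes from an admissible family -/

theorem exists_mem_last_eq_one {L : Line} (hL : IsTwoSecant L) : ∃ v ∈ L.1, v 3 = 1 := by
  obtain ⟨p, hp, hpL⟩ : {p : Point | p ∈ Q ∧ Incident p L}.Nonempty :=
    Set.nonempty_of_ncard_ne_zero (by rw [IsTwoSecant] at hL; omega)
  obtain ⟨x, y, z, -, rfl⟩ := hp
  exact ⟨_, incident_aff.1 hpL, by simp⟩

namespace IsGlStar

variable {S : Set Line}

theorem exists_mem (h : IsGlStar S) {v : E} (hv : v ≠ 0) (hq : 0 ≤ qf v) :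
    ∃ L ∈ S, v ∈ L.1 := by
  obtain ⟨L, ⟨hL, hi⟩, -⟩ := h.existsUnique_line (pointOf v hv) (by
    rw [isInterior_iff, not_lt]
    exact hq)
  exact ⟨L, hL, incident_pointOf.1 hi⟩

theorem eq_of_mem (h : IsGlStar S) {v : E} (hv : v ≠ 0) (hq : 0 ≤ qf v) {L L' : Line}
    (hL : L ∈ S) (hL' : L' ∈ S) (hvL : v ∈ L.1) (hvL' : v ∈ L'.1) : L = L' :=
  (h.existsUnique_line (pointOf v hv) (by
    rw [isInterior_iff, not_lt]
    exact hq)).unique ⟨hL, incident_pointOf.2 hvL⟩ ⟨hL', incident_pointOf.2 hvL'⟩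

/-- The half-turn fixes the point at infinity of `Z`, hence also its star line. The midpoint of an
affine point of that line and its image lies on `Z`. -/
theorem zAxis_mem (h : IsGlStar S) (hS : IsRotational S) : zAxis ∈ S := by
  have he : (!₂[0, 0, 1, 0] : E) ≠ 0 := fun h0 => by
    simpa using congrArg (fun v : E => v 2) h0
  have hq : 0 ≤ qf !₂[0, 0, 1, 0] := by simp [qf]
  obtain ⟨L, hL, heL⟩ := h.exists_mem he hq
  have hrot : rotGr Real.pi L = L := by
    refine h.eq_of_mem he hq (hS _ L hL) hL ?_ heL
    rw [mem_rotGr]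
    convert heL using 1
    simp [rot_apply]
  obtain ⟨v, hv, hv3⟩ := exists_mem_last_eq_one (h.two_secant L hL)
  have hv' : rot (-Real.pi) v ∈ L.1 := by
    rw [← mem_rotGr, hrot]
    exact hv
  convert hL
  symm
  apply line_eq_lineOf _ _ heL
  convert L.1.sub_mem (L.1.smul_mem (1 / 2) (L.1.add_mem hv hv')) (L.1.smul_mem (v 2) heL) using 1
  apply ext_coords <;> simp [rot_apply, hv3] <;> ring

end IsGlStar

/-- The direction `(1, 0, a)`, as a vector at infinity. -/
def dir (a : ℝ) : E := !₂[1, 0, a, 0]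

theorem dir_ne_zero (a : ℝ) : dir a ≠ 0 := fun h0 => by
  simpa [dir] using congrArg (fun v : E => v 0) h0

theorem qf_dir (a : ℝ) : 0 ≤ qf (dir a) := by
  simp [qf, dir]
  positivity

theorem dir_mem_genLine (a b σ : ℝ) : dir a ∈ (genLine 0 a b σ).1 :=
  mem_genLine.2 ⟨1, by simp [dir], by simp [dir], by simp [dir]⟩

theorem genLine_inj {a b σ b' σ' : ℝ} (h : genLine 0 a b σ = genLine 0 a b' σ') :
    b = b' ∧ σ = σ' := by
  have h1 : (!₂[0, -σ, b, 1] : E) ∈ (genLine 0 a b σ).1 :=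
    mem_genLine.2 ⟨0, by simp, by simp, by simp⟩
  rw [h] at h1
  obtain ⟨t, h0, h1, h2⟩ := mem_genLine.1 h1
  simp at h0 h1 h2
  subst h0
  exact ⟨by simpa using h2, h1⟩

theorem slope_eq_of_genLine_eq {θ θ' a a' b b' σ σ' : ℝ} (ha : 0 ≤ a) (ha' : 0 ≤ a')
    (h : genLine θ a b σ = genLine θ' a' b' σ') : a = a' := by
  have h1 : (!₂[Real.cos θ, Real.sin θ, a, 0] : E) ∈ (genLine θ a b σ).1 :=
    mem_genLine.2 ⟨1, by simp, by simp, by simp⟩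
  rw [h] at h1
  obtain ⟨t, h0, h1, h2⟩ := mem_genLine.1 h1
  simp at h0 h1 h2
  have hcs := Real.sin_sq_add_cos_sq θ
  rw [h0, h1] at hcs
  have ht : t ^ 2 = 1 := by
    linear_combination hcs - t ^ 2 * Real.sin_sq_add_cos_sq θ'
  rw [← sq_eq_sq₀ ha ha', h2]
  linear_combination a' ^ 2 * ht

namespace IsTopologicalRotationalGlStarInStandardPosition

variable {S : Set Line}

theorem horizontal_mem (h : IsTopologicalRotationalGlStarInStandardPosition S) (θ : ℝ) :
    genLine θ 0 0 0 ∈ S := by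
  rw [← rotGr_xAxis]
  exact h.rotational θ _ h.xAxis_mem

/-- The inequality says that the crossing point with `z = 0` is interior. Otherwise that point also
lies on a rotate of `X`, and uniqueness would make the line horizontal. -/
theorem exists_genLine (h : IsTopologicalRotationalGlStarInStandardPosition S) {a : ℝ}
    (ha : 0 < a) : ∃ b σ : ℝ, genLine 0 a b σ ∈ S ∧ b ^ 2 + (a * σ) ^ 2 < a ^ 2 := by
  obtain ⟨L, hL, hd⟩ := h.exists_mem (dir_ne_zero a) (qf_dir a)
  obtain ⟨v, hv, hv3⟩ := exists_mem_last_eq_one (h.two_secant L hL)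
  have hLeq : L = genLine 0 a (v 2 - v 0 * a) (-v 1) := by
    apply line_eq_lineOf
    · convert L.1.sub_mem hv (L.1.smul_mem (v 0) hd) using 1
      apply ext_coords <;> simp [dir, hv3]
    · convert hd using 1
      simp [dir]
  refine ⟨v 2 - v 0 * a, -v 1, hLeq ▸ hL, ?_⟩
  by_contra hle
  push Not at hle
  set b := v 2 - v 0 * a with hb
  set u : E := !₂[-(b / a), v 1, 0, 1] with hu
  have hu0 : u ≠ 0 := hom_ne_zero _ _ _
  have huL : u ∈ L.1 := by
    rw [hLeq, mem_genLine]
    refine ⟨-(b / a), by simp [hu], by simp [hu], ?_⟩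
    simp [hu]
    field_simp
    ring
  have hq : 0 ≤ qf u := by
    have h1 : qf u = (b ^ 2 + (a * -v 1) ^ 2 - a ^ 2) / a ^ 2 := by
      simp [qf, hu]
      field_simp
    rw [h1]
    exact div_nonneg (by linarith) (by positivity)
  obtain ⟨θ, h0, h1⟩ := exists_rotation (x := -(b / a)) (y := v 1)
    (r := Real.sqrt ((b / a) ^ 2 + v 1 ^ 2)) (s := 0) (by
      rw [Real.sq_sqrt (by positivity)]
      ring)
  have hX : L = genLine θ 0 0 0 := by
    refine h.eq_of_mem hu0 hq hL (h.horizontal_mem θ) huL ?_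
    refine mem_genLine.2 ⟨Real.sqrt ((b / a) ^ 2 + v 1 ^ 2), ?_, ?_, by simp [hu]⟩
    · simp only [zero_mul, sub_zero] at h0
      simpa [hu] using h0
    · simp only [zero_mul, add_zero] at h1
      simpa [hu] using h1
  exact ha.ne' (slope_eq_of_genLine_eq ha.le le_rfl (hLeq.symm.trans hX))

/-- The profile of a gl star. -/
theorem exists_profile (h : IsTopologicalRotationalGlStarInStandardPosition S) :
    ∃ b σ : ℝ → ℝ, Profile b σ ∧ S = profileStar b σ := by
  have hex : ∀ a : ℝ, ∃ b σ : ℝ, (0 ≤ a → genLine 0 a b σ ∈ S) ∧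
      (0 < a → b ^ 2 + (a * σ) ^ 2 < a ^ 2) ∧ (a = 0 → b = 0 ∧ σ = 0) := by
    intro a
    by_cases ha : 0 < a
    · obtain ⟨b, σ, h1, h2⟩ := h.exists_genLine ha
      exact ⟨b, σ, fun _ => h1, fun _ => h2, fun h0 => absurd h0 ha.ne'⟩
    · refine ⟨0, 0, fun ha' => ?_, fun ha' => absurd ha' ha, fun _ => ⟨rfl, rfl⟩⟩
      rw [le_antisymm (not_lt.1 ha) ha']
      exact h.horizontal_mem 0
  choose b σ hmem hlt hzero using hex
  obtain ⟨f, hf, hfS⟩ := h.continuous_line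
  have hext : ∀ a, ¬ IsInterior (pointOf (dir a) (dir_ne_zero a)) := fun a => by
    rw [isInterior_iff, not_lt]
    exact qf_dir a
  set g : ℝ → Line := fun a => f ⟨pointOf (dir a) (dir_ne_zero a), hext a⟩ with hg
  have hgc : Continuous g := by
    refine hf.comp (Continuous.subtype_mk (continuous_pointOf ?_ _) _)
    unfold dir
    fun_prop
  have hgS : ∀ a, g a ∈ S := fun a => (hfS _).1
  have hgeq : ∀ {a b' σ' : ℝ}, genLine 0 a b' σ' ∈ S → g a = genLine 0 a b' σ' :=
    fun {a b' σ'} hm => h.eq_of_mem (dir_ne_zero a) (qf_dir a) (hgS a) hm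
      (incident_pointOf (h := dir_ne_zero a).1 (hfS ⟨pointOf (dir a) _, hext a⟩).2)
      (dir_mem_genLine a b' σ')
  -- Near `a₀` the inequality (1) confines `(b, σ)` to a compact box. At any cluster point the
  -- limiting line is `g a₀` by continuity of the star, and this line determines `b` and `σ`.
  have hcont : ContinuousOn (fun a => (b a, σ a)) (Ici 0) := by
    intro a₀ ha₀
    have hK : IsCompact (Icc (-(a₀ + 1)) (a₀ + 1) ×ˢ Icc (-1 : ℝ) 1) :=
      isCompact_Icc.prod isCompact_Icc
    refine hK.tendsto_nhds_of_unique_mapClusterPt ?_ ?_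
    · filter_upwards [self_mem_nhdsWithin, mem_nhdsWithin_of_mem_nhds
        (Iio_mem_nhds (lt_add_one a₀))] with a ha ha1
      rcases (mem_Ici.1 ha).eq_or_lt with rfl | ha
      · have ha₀ : 0 ≤ a₀ := ha₀
        simp only [mem_prod, mem_Icc, hzero 0 rfl]
        exact ⟨⟨by linarith, by linarith⟩, by norm_num, by norm_num⟩
      · have h1 := hlt a ha
        have ha1 : a < a₀ + 1 := ha1
        have hb : |b a| ≤ a := abs_le_of_sq_le_sq (by nlinarith [sq_nonneg (a * σ a)]) ha.le
        have hs : |σ a| ≤ 1 := by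
          refine abs_le_of_sq_le_sq ?_ zero_le_one
          have : a ^ 2 * σ a ^ 2 ≤ a ^ 2 * 1 ^ 2 := by nlinarith [sq_nonneg (b a)]
          exact le_of_mul_le_mul_left this (by positivity)
        rw [abs_le] at hb hs
        exact ⟨⟨by linarith, by linarith⟩, hs⟩
    · rintro ⟨b₀, σ₀⟩ - hcl
      obtain ⟨U, hU, hlim⟩ := mapClusterPt_iff_ultrafilter.1 hcl
      have hUa : Tendsto (fun a : ℝ => a) U (𝓝 a₀) := hU.trans nhdsWithin_le_nhds
      have h1 : Tendsto (fun a => genLine 0 a (b a) (σ a)) U (𝓝 (genLine 0 a₀ b₀ σ₀)) :=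
        tendsto_genLine 0 hUa hlim
      have h2 : Tendsto (fun a => genLine 0 a (b a) (σ a)) U (𝓝 (g a₀)) := by
        refine ((hgc.tendsto a₀).comp hUa).congr' ?_
        filter_upwards [hU self_mem_nhdsWithin] with a ha
        exact hgeq (hmem a ha)
      have h3 := tendsto_nhds_unique h1 h2
      rw [hgeq (hmem a₀ ha₀)] at h3
      obtain ⟨rfl, rfl⟩ := genLine_inj h3
      rfl
  refine ⟨b, σ, ⟨continuous_fst.comp_continuousOn hcont, continuous_snd.comp_continuousOn hcont,
    (hzero 0 rfl).1, (hzero 0 rfl).2, hlt⟩, ?_⟩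
  have hsub : profileStar b σ ⊆ S := by
    rintro L (rfl | ⟨a, ha, θ, rfl⟩)
    · exact h.zAxis_mem h.rotational
    · have := h.rotational θ _ (hmem a ha)
      rwa [rotGr_genLine, add_zero] at this
  refine Subset.antisymm ?_ hsub
  intro L hL
  -- The point at infinity of `L` is non-interior and lies on a line of the profile, so uniqueness
  -- identifies the two lines.
  obtain ⟨d, hd, hd0, hd3⟩ := exists_mem_infinity L
  obtain ⟨d, hd, hd0, hd3, hd2⟩ : ∃ d ∈ L.1, d ≠ 0 ∧ d 3 = 0 ∧ 0 ≤ d 2 := by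
    rcases le_total 0 (d 2) with h2 | h2
    · exact ⟨d, hd, hd0, hd3, h2⟩
    · exact ⟨-d, L.1.neg_mem hd, neg_ne_zero.2 hd0, by simp [hd3], by simpa using h2⟩
  have hq : 0 ≤ qf d := by
    simp only [qf, hd3]
    nlinarith [sq_nonneg (d 0), sq_nonneg (d 1), sq_nonneg (d 2)]
  suffices ∃ L' ∈ profileStar b σ, d ∈ L'.1 by
    obtain ⟨L', hL', hd'⟩ := this
    rwa [h.eq_of_mem hd0 hq hL (hsub hL') hd hd']
  by_cases h01 : d 0 = 0 ∧ d 1 = 0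
  · exact ⟨zAxis, Or.inl rfl, mem_zAxis.2 h01⟩
  · have hpos : 0 < d 0 ^ 2 + d 1 ^ 2 := by
      by_contra hneg
      exact h01 ⟨by nlinarith [sq_nonneg (d 0), sq_nonneg (d 1)],
        by nlinarith [sq_nonneg (d 0), sq_nonneg (d 1)]⟩
    have hr := Real.sqrt_pos.2 hpos
    obtain ⟨θ, h0, h1⟩ := exists_angle hr (Real.sq_sqrt hpos.le).symm
    refine ⟨_, Or.inr ⟨d 2 / Real.sqrt (d 0 ^ 2 + d 1 ^ 2), div_nonneg hd2 hr.le, θ, rfl⟩, ?_⟩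
    rw [mem_genLine]
    refine ⟨Real.sqrt (d 0 ^ 2 + d 1 ^ 2), ?_, ?_, ?_⟩
    · rw [hd3]
      linarith
    · rw [hd3]
      linarith
    · rw [hd3]
      field_simp
      ring

end IsTopologicalRotationalGlStarInStandardPosition

/-! ### Admissibility of the functions and hands obtained from a star -/

theorem exists_mem_genLine_of_mem_H {b c σ : ℝ → ℝ} {a x z : ℝ} (ha : 0 < a)
    (hc : c a ^ 2 = (a * σ a) ^ 2) (hH : (x, z) ∈ H b c a) :
    ∃ θ : ℝ, (!₂[x, 0, z, 1] : E) ∈ (genLine θ a (b a) (σ a)).1 := by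
  simp only [H, mem_ofPred_eq, hc] at hH
  obtain ⟨θ, h0, h1⟩ := exists_rotation (x := x) (y := 0) (r := (z - b a) / a) (s := -σ a) (by
    field_simp
    linear_combination hH)
  refine ⟨θ, mem_genLine.2 ⟨(z - b a) / a, ?_, ?_, ?_⟩⟩
  · simp
    linear_combination h0
  · simp
    linear_combination h1
  · simp
    field_simp
    ring

theorem mem_H_of_mem_genLine {b c σ : ℝ → ℝ} {a x z θ : ℝ} (hc : c a ^ 2 = (a * σ a) ^ 2)
    (h : (!₂[x, 0, z, 1] : E) ∈ (genLine θ a (b a) (σ a)).1) : (x, z) ∈ H b c a := by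
  obtain ⟨t, h0, h1, h2⟩ := mem_genLine.1 h
  have hsq := sq_add_sq_of_mem_genLine h0 h1
  simp at hsq h2
  simp only [H, mem_ofPred_eq, hc, h2]
  linear_combination a ^ 2 * hsq

theorem Profile.admissible {b σ : ℝ → ℝ} (hp : Profile b σ) (hS : IsGlStar (profileStar b σ)) :
    Admissible b (fun a => a * |σ a|) := by
  have hc : ∀ a, (a * |σ a|) ^ 2 = (a * σ a) ^ 2 := fun a => by
    rw [mul_pow, mul_pow, sq_abs]
  -- A point of `H_a` lies on a star line of slope `a`; a non-interior point has only one star line,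
  -- and that line has only one slope.
  have hinj : ∀ x z : ℝ, 1 ≤ x ^ 2 + z ^ 2 → ∀ a a' : ℝ, 0 < a → 0 < a' →
      (x, z) ∈ H b (fun a => a * |σ a|) a → (x, z) ∈ H b (fun a => a * |σ a|) a' → a = a' := by
    intro x z hxz a a' ha ha' h1 h2
    obtain ⟨θ, h1⟩ := exists_mem_genLine_of_mem_H ha (hc a) h1
    obtain ⟨θ', h2⟩ := exists_mem_genLine_of_mem_H ha' (hc a') h2
    refine slope_eq_of_genLine_eq ha.le ha'.le (hS.eq_of_mem (hom_ne_zero x 0 z) ?_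
      (Or.inr ⟨a, ha.le, θ, rfl⟩) (Or.inr ⟨a', ha'.le, θ', rfl⟩) h1 h2)
    simp [qf]
    linarith
  refine ⟨?_, ?_, ?_, ?_, ?_, ?_, ?_, ?_⟩
  · exact hp.continuousOn_b.mono Ioi_subset_Ici_self
  · exact continuousOn_id.mul (hp.continuousOn_σ.mono Ioi_subset_Ici_self).abs
  · intro a ha
    positivity
  · intro a ha
    rw [hc]
    exact hp.sq_lt a ha
  · have := (hp.continuousOn_b 0 self_mem_Ici).mono Ioi_subset_Ici_self
    rwa [ContinuousWithinAt, hp.b_zero] at this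
  · have := ((hp.continuousOn_σ 0 self_mem_Ici).mono Ioi_subset_Ici_self).abs
    rw [ContinuousWithinAt, hp.σ_zero, abs_zero] at this
    refine this.congr' ?_
    filter_upwards [self_mem_nhdsWithin] with a ha
    rw [mul_div_cancel_left₀ _ (ne_of_gt ha)]
  · intro t ht ht0
    have ht2 : 0 < 1 - t ^ 2 := by nlinarith [ht.1, ht.2]
    have hsq := Real.sq_sqrt ht2.le
    obtain ⟨L, hL, hm⟩ := hS.exists_mem (hom_ne_zero (Real.sqrt (1 - t ^ 2)) 0 t) (by
      simp [qf, hsq])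
    rcases hL with rfl | ⟨a, ha, θ, rfl⟩
    · have := (mem_zAxis.1 hm).1
      simp at this
      exact absurd this (Real.sqrt_pos.2 ht2).ne'
    · rcases ha.eq_or_lt with rfl | ha
      · obtain ⟨s, -, -, h2⟩ := mem_genLine.1 hm
        simp [hp.b_zero] at h2
        exact absurd h2 ht0
      · have hH := mem_H_of_mem_genLine (c := fun a => a * |σ a|) (hc a) hm
        exact ⟨a, ⟨ha, hH⟩, fun a' h' => hinj _ _ (by linarith) a' a h'.1 ha h'.2 hH⟩
  · exact fun x z _ _ hxz => hinj x z hxz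

/-- The hand of a line with a given value of `σ`. -/
def handOf (s : ℝ) : Hand := if 0 < s then .right else .left

/-- The hand assigned to `s = 0` is immaterial, since `|s|` vanishes there. -/
theorem sign_handOf (s : ℝ) : (handOf s).sign * |s| = s := by
  unfold handOf
  split_ifs with h
  · simp [Hand.sign, abs_of_pos h]
  · simp [Hand.sign, abs_of_nonpos (not_lt.1 h)]

/-- By the intermediate value theorem, `σ` cannot change sign on an interval where it has no zero.
-/
theorem Profile.admissibleChoice {b σ : ℝ → ℝ} (hp : Profile b σ) :
    AdmissibleChoice (fun a => a * |σ a|) (fun a => handOf (σ a)) := by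
  intro a a' ha haa' hne
  have hcont : ContinuousOn σ (Icc a a') := hp.continuousOn_σ.mono fun r hr => ha.le.trans hr.1
  have hzero : (0 : ℝ) ∉ σ '' Icc a a' := by
    rintro ⟨r, hr, h0⟩
    exact hne r hr (by simp [h0])
  simp only [handOf]
  by_cases h1 : 0 < σ a <;> by_cases h2 : 0 < σ a'
  · rw [if_pos h1, if_pos h2]
  · exact absurd (intermediate_value_Icc' haa' hcont ⟨not_lt.1 h2, h1.le⟩) hzero
  · exact absurd (intermediate_value_Icc haa' hcont ⟨not_lt.1 h1, h2.le⟩) hzero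
  · rw [if_neg h1, if_neg h2]

theorem Profile.star_eq {b σ : ℝ → ℝ} (hp : Profile b σ) :
    star b (fun a => a * |σ a|) (fun a => handOf (σ a)) = profileStar b σ := by
  refine star_eq_profileStar (fun a ha => by positivity) (fun _ _ => rfl) (fun a ha => ?_)
    hp.b_zero hp.σ_zero
  rw [mul_div_cancel_left₀ _ ha.ne', sign_handOf]

end GlStar

end

theorem theorem6 :
    (∀ (b c : ℝ → ℝ) (ε : ℝ → GlStar.Hand),
      GlStar.Admissible b c → GlStar.AdmissibleChoice c ε →
        GlStar.IsTopologicalRotationalGlStarInStandardPosition (GlStar.star b c ε)) ∧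
    (∀ S : Set GlStar.Line, GlStar.IsTopologicalRotationalGlStarInStandardPosition S →
      ∃ (b c : ℝ → ℝ) (ε : ℝ → GlStar.Hand),
        GlStar.Admissible b c ∧ GlStar.AdmissibleChoice c ε ∧ S = GlStar.star b c ε) := by
  refine ⟨fun b c ε h hε => h.isTopologicalRotationalGlStar hε, fun S hS => ?_⟩
  obtain ⟨b, σ, hp, rfl⟩ := hS.exists_profile
  exact ⟨b, _, _, hp.admissible hS.toIsGlStar, hp.admissibleChoice, hp.star_eq.symm⟩
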